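/- Let $v_1,\dots,v_6\in\mathbb R^3$ be vectors whose orthogonal projections to the $xy$-plane $\mathbb R^2$ are, in some order, the six successive edge vectors of a (nondegenerate) regular hexagon; their $z$-components are arbitrary real numbers. Let $\sigma$ be any permutation of $\{1,\dots,6\}$, and place $v_{\sigma(1)},\dots,v_{\sigma(6)}$ tip to tail in this order, starting at the origin. If the resulting polygonal curve in $\mathbb R^3$ is a knot, i.e. if it is closed ($\sum_i v_i=0$) and has no self-intersections, then it is the trivial knot: there is an ambient isotopy of $\mathbb R^3$ that carries it onto a round circle. -/

import Mathlib

/-- Euclidean three-space. -/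
abbrev Space := EuclideanSpace ℝ (Fin 3)

/-- The Euclidean plane. -/
abbrev Plane := EuclideanSpace ℝ (Fin 2)

/-- The projection to the plane that forgets the height (the last coordinate). -/
def planeProj (x : Space) : Plane := !₂[x 0, x 1]

/-- The `k`-th vertex of the regular `n`-gon with centre `c`, circumradius `r` and phase `θ`. -/
noncomputable def regularVertex {n : ℕ} (c : Plane) (r θ : ℝ) (k : Fin n) : Plane :=
  c + r • !₂[Real.cos (θ + 2 * Real.pi * (k : ℕ) / n), Real.sin (θ + 2 * Real.pi * (k : ℕ) / n)]

/-- The `n` vectors of `v` project, in some order `τ`, to the successive edges of a nondegenerate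
regular `n`-gon in the plane. (The index `k + 1` is cyclic.) -/
def ProjectsToRegularPolygon {n : ℕ} [NeZero n] (v : Fin n → Space) : Prop :=
  ∃ (c : Plane) (r θ : ℝ) (τ : Equiv.Perm (Fin n)), 0 < r ∧
    ∀ k : Fin n, planeProj (v (τ k)) = regularVertex c r θ (k + 1) - regularVertex c r θ k

/-- The vectors `w 0, w 1, …` are placed tip to tail, from the origin on: the tail of `w k`. -/
noncomputable def tail {n : ℕ} (w : Fin n → Space) (k : Fin n) : Space :=
  ∑ i ∈ Finset.Iio k, w i

/-- The polygonal curve traced by the vectors `w 0, w 1, …` placed tip to tail. -/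
def polygonalCurve {n : ℕ} (w : Fin n → Space) : Set Space :=
  ⋃ k : Fin n, segment ℝ (tail w k) (tail w k + w k)

/-- The vectors `w 0, w 1, …` placed tip to tail form a simple closed polygon: the last tip is the
first tail, and the curve, run through once without its final point, is injective. -/
def IsSimpleClosed {n : ℕ} (w : Fin n → Space) : Prop :=
  ∑ i, w i = 0 ∧
    Function.Injective (fun p : Fin n × Set.Ico (0 : ℝ) 1 => tail w p.1 + (p.2 : ℝ) • w p.1)

/-- Ambient isotopy of subsets of three-space. -/
def AmbientIsotopic (K L : Set Space) : Prop :=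
  ∃ H : unitInterval → (Space ≃ₜ Space),
    Continuous (fun p : unitInterval × Space => H p.1 p.2) ∧
      (∀ x, H 0 x = x) ∧ H 1 '' K = L

/-- The round unit circle in the horizontal coordinate plane. -/
def standardCircle : Set Space := {x | x 0 ^ 2 + x 1 ^ 2 = 1 ∧ x 2 = 0}

/-- A trivial knot: ambient isotopic to the round circle. -/
def IsUnknot (K : Set Space) : Prop := AmbientIsotopic K standardCircle

/-! The curve is shown to have bridge number one. If a linear functional `a x + b y + z` rises along
one cyclic block of edges and falls along the complementary one, a shear turns it into the height,
and the knot becomes two arcs that are graphs over the same height interval and meet only at their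
ends. With horizontal planes read as `ℂ`, dividing at each height by a nonvanishing multiple of the
difference of the arcs, and then translating, puts the knot into a vertical plane as a square
(`IsGraphArc.isotopic_horizontalCircle`, `IsSimpleClosed.isUnknot_of_unimodal`).

It remains to find the functional. Its restriction to the plane is free, so the heights `z k` of the
edges may be changed by any linear function of their hexagon directions. Up to rotation, every
ordering of the six directions has one of four shapes (`hasForm_of_injective`). For `IsHalfSplit` a
steep tilt suffices. For the others, embeddedness supplies sign conditions: two distinct vertices
over the same point of the plane have different heights, and two edges over the same segment do not
cross. Under these conditions explicit tilts exist (`IsSimpleClosed.isTiltable`). -/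

/-! ### Ambient isotopies of `ℂ × ℝ` -/

/-- Ambient isotopy of subsets of a topological space. -/
def Isotopic {X : Type*} [TopologicalSpace X] (K L : Set X) : Prop :=
  ∃ H : unitInterval → (X ≃ₜ X),
    Continuous (fun p : unitInterval × X => H p.1 p.2) ∧ (∀ x, H 0 x = x) ∧ H 1 '' K = L

theorem Isotopic.trans {X : Type*} [TopologicalSpace X] {K L M : Set X}
    (h : Isotopic K L) (h' : Isotopic L M) : Isotopic K M := by
  obtain ⟨H, hc, h0, h1⟩ := h
  obtain ⟨H', hc', h0', h1'⟩ := h'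
  refine ⟨fun t => (H t).trans (H' t), ?_, ?_, ?_⟩
  · exact hc'.comp (continuous_fst.prodMk hc)
  · intro x
    simp [h0, h0']
  · rw [← h1', ← h1, Set.image_image]
    rfl

theorem Isotopic.conj {X Y : Type*} [TopologicalSpace X] [TopologicalSpace Y] (e : X ≃ₜ Y)
    {K L : Set X} (h : Isotopic (e '' K) (e '' L)) : Isotopic K L := by
  obtain ⟨H, hc, h0, h1⟩ := h
  refine ⟨fun t => (e.trans (H t)).trans e.symm, ?_, ?_, ?_⟩
  · exact e.symm.continuous.comp
      (hc.comp (continuous_fst.prodMk (e.continuous.comp continuous_snd)))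
  · intro x
    simp [h0]
  · apply e.injective.image_injective
    rw [← h1, Set.image_image, Set.image_image]
    simp

/-- A continuous family of invertible maps starting at the identity is an ambient isotopy. -/
theorem Isotopic.of_maps {X : Type*} [TopologicalSpace X] {K L : Set X}
    (F G : unitInterval → X → X)
    (hF : Continuous fun p : unitInterval × X => F p.1 p.2)
    (hG : Continuous fun p : unitInterval × X => G p.1 p.2)
    (hGF : ∀ t x, G t (F t x) = x) (hFG : ∀ t x, F t (G t x) = x)
    (h0 : ∀ x, F 0 x = x) (h1 : F 1 '' K = L) : Isotopic K L :=
  ⟨fun t =>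
    { toFun := F t
      invFun := G t
      left_inv := hGF t
      right_inv := hFG t
      continuous_toFun := hF.comp (continuous_const.prodMk continuous_id)
      continuous_invFun := hG.comp (continuous_const.prodMk continuous_id) }, hF, h0, h1⟩

/-- Vertical shears are realized by ambient isotopies. -/
theorem isotopic_shear (K : Set (ℂ × ℝ)) (g : ℂ → ℝ) (hg : Continuous g) :
    Isotopic K ((fun p : ℂ × ℝ => (p.1, p.2 + g p.1)) '' K) := by
  refine Isotopic.of_maps (fun t p => (p.1, p.2 + (t : ℝ) * g p.1))
    (fun t p => (p.1, p.2 - (t : ℝ) * g p.1)) ?_ ?_ ?_ ?_ ?_ ?_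
  · fun_prop
  · fun_prop
  · intro t x; simp
  · intro t x; simp
  · intro x; simp
  · simp

/-- Fibrewise affine maps are realized by ambient isotopies when their linear parts are
contractible through invertible ones. -/
theorem isotopic_fibrewise_affine (K : Set (ℂ × ℝ)) (a : unitInterval → ℝ → ℂ) (b : ℝ → ℂ)
    (ha : Continuous fun p : unitInterval × ℝ => a p.1 p.2) (hb : Continuous b)
    (ha0 : ∀ t z, a t z ≠ 0) (hone : ∀ z, a 0 z = 1) :
    Isotopic K ((fun p : ℂ × ℝ => (a 1 p.2 * p.1 + b p.2, p.2)) '' K) := by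
  have ha' : Continuous fun p : unitInterval × (ℂ × ℝ) => a p.1 p.2.2 :=
    ha.comp (continuous_fst.prodMk (continuous_snd.comp continuous_snd))
  refine Isotopic.of_maps (fun t p => (a t p.2 * p.1 + (t : ℝ) * b p.2, p.2))
    (fun t p => ((a t p.2)⁻¹ * (p.1 - (t : ℝ) * b p.2), p.2)) ?_ ?_ ?_ ?_ ?_ ?_
  · fun_prop
  · have hb' : Continuous fun p : unitInterval × (ℂ × ℝ) => p.2.1 - (p.1 : ℝ) * b p.2.2 := by
      fun_prop
    exact ((ha'.inv₀ fun p => ha0 _ _).mul hb').prodMk (continuous_snd.comp continuous_snd)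
  · intro t x
    ext1
    · simp [ha0 t x.2]
    · rfl
  · intro t x
    ext1
    · simp [ha0 t x.2]
    · rfl
  · intro x; simp [hone]
  · simp

/-- Fibrewise division by a nowhere vanishing continuous function of the height, followed by a
fibrewise translation, is realized by an ambient isotopy. -/
theorem isotopic_divide (K : Set (ℂ × ℝ)) (q b : ℝ → ℂ) (hq : Continuous q) (hb : Continuous b)
    (hq0 : ∀ z, q z ≠ 0) :
    Isotopic K ((fun p : ℂ × ℝ => (p.1 / q p.2 + b p.2, p.2)) '' K) := by
  have h := isotopic_fibrewise_affine K
    -- The line of heights is contractible: `q (t * z)` runs from the constant `q 0` to `q z`, while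
    -- the exponential runs from `1` to `(q 0)⁻¹`. The quotient never vanishes and joins `1` to `(q
    -- z)⁻¹`.
    (fun t z => Complex.exp (-(t : ℝ) * Complex.log (q 0)) * q 0 / q ((t : ℝ) * z)) b ?_ hb ?_ ?_
  · convert h using 3 with p
    simp [Complex.exp_neg, Complex.exp_log (hq0 0), hq0 0]
    field_simp
  · refine Continuous.div ?_ ?_ (fun _ => hq0 _) <;> fun_prop
  · intro t z
    exact div_ne_zero (mul_ne_zero (Complex.exp_ne_zero _) (hq0 0)) (hq0 _)
  · intro z
    simp [hq0 0]

/-- Positive factors are joined to `1` linearly without passing through zero. -/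
theorem isotopic_rescale (K : Set (ℂ × ℝ)) {k m : ℝ} (hk : 0 < k) (hm : 0 < m) (n : ℝ) :
    Isotopic K ((fun p : ℂ × ℝ => ((k : ℂ) * p.1, m * p.2 + n)) '' K) := by
  have key : ∀ {s : ℝ}, 0 < s → ∀ t : unitInterval, (1 - (t : ℝ) + t * s) ≠ 0 := by
    intro s hs t
    have h0 := t.2.1
    have h1 := t.2.2
    rcases h0.eq_or_lt with h | h
    · rw [← h]; norm_num
    · nlinarith
  have keyc : ∀ t : unitInterval, ((1 - (t : ℝ) + t * k : ℝ) : ℂ) ≠ 0 := fun t => by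
    exact_mod_cast key hk t
  refine Isotopic.of_maps
    (fun t p => (((1 - (t : ℝ) + t * k : ℝ) : ℂ) * p.1, (1 - (t : ℝ) + t * m) * p.2 + t * n))
    (fun t p => (((1 - (t : ℝ) + t * k : ℝ) : ℂ)⁻¹ * p.1, (1 - (t : ℝ) + t * m)⁻¹ * (p.2 - t * n)))
    ?_ ?_ ?_ ?_ ?_ ?_
  · fun_prop
  · have h1 : Continuous fun p : unitInterval × (ℂ × ℝ) => ((1 - (p.1 : ℝ) + p.1 * k : ℝ) : ℂ)⁻¹ :=
      Continuous.inv₀ (by fun_prop) (fun p => keyc p.1)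
    have h2 : Continuous fun p : unitInterval × (ℂ × ℝ) => (1 - (p.1 : ℝ) + p.1 * m)⁻¹ :=
      Continuous.inv₀ (by fun_prop) (fun p => key hm p.1)
    fun_prop
  · intro t x
    ext1
    · exact inv_mul_cancel_left₀ (keyc t) _
    · simp [key hm t]
  · intro t x
    ext1
    · exact mul_inv_cancel_left₀ (keyc t) _
    · simp [key hm t]
  · intro x; simp
  · simp

/-! ### From a vertical square to the round circle -/

/-- The square `|x| + |y| = 1` in the vertical coordinate plane over the real axis. -/
def verticalSquare : Set (ℂ × ℝ) := {p | p.1.im = 0 ∧ |p.1.re| + |p.2| = 1}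

/-- The square `|x| + |y| = 1` in the horizontal coordinate plane. -/
def horizontalSquare : Set (ℂ × ℝ) := {p | p.2 = 0 ∧ |p.1.re| + |p.1.im| = 1}

/-- The unit circle in the horizontal coordinate plane. -/
def horizontalCircle : Set (ℂ × ℝ) := {p | p.2 = 0 ∧ ‖p.1‖ = 1}

/-- A quarter turn about the real axis. -/
theorem isotopic_verticalSquare_horizontalSquare : Isotopic verticalSquare horizontalSquare := by
  refine Isotopic.of_maps
    (fun t p => (⟨p.1.re, Real.cos (t * (Real.pi / 2)) * p.1.im + Real.sin (t * (Real.pi / 2)) * p.2⟩,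
      -Real.sin (t * (Real.pi / 2)) * p.1.im + Real.cos (t * (Real.pi / 2)) * p.2))
    (fun t p => (⟨p.1.re, Real.cos (t * (Real.pi / 2)) * p.1.im - Real.sin (t * (Real.pi / 2)) * p.2⟩,
      Real.sin (t * (Real.pi / 2)) * p.1.im + Real.cos (t * (Real.pi / 2)) * p.2))
    ?_ ?_ ?_ ?_ ?_ ?_
  · simp only [Complex.mk_eq_add_mul_I]
    fun_prop
  · simp only [Complex.mk_eq_add_mul_I]
    fun_prop
  · rintro t ⟨x, z⟩
    have := Real.sin_sq_add_cos_sq (t * (Real.pi / 2))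
    ext1
    · apply Complex.ext
      · rfl
      · simp only
        linear_combination x.im * this
    · simp only
      linear_combination z * this
  · rintro t ⟨x, z⟩
    have := Real.sin_sq_add_cos_sq (t * (Real.pi / 2))
    ext1
    · apply Complex.ext
      · rfl
      · simp only
        linear_combination x.im * this
    · simp only
      linear_combination z * this
  · rintro ⟨x, z⟩; simp
  · ext ⟨x, z⟩
    simp only [Set.mem_image, verticalSquare, horizontalSquare, Set.mem_ofPred_eq, Prod.exists]
    constructor
    · rintro ⟨y, w, ⟨h1, h2⟩, h3⟩
      simp only [Prod.mk.injEq, Set.Icc.coe_one] at h3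
      obtain ⟨h3, h4⟩ := h3
      rw [← h3, ← h4]
      simp [h1, h2]
    · rintro ⟨h1, h2⟩
      refine ⟨x.re, x.im, by simp [h2], ?_⟩
      simp [h1]

/-- Each ray from the origin is stretched by the ratio of the `ℓ¹` norm to the Euclidean norm. -/
theorem isotopic_horizontalSquare_horizontalCircle :
    Isotopic horizontalSquare horizontalCircle := by
  set N : ℂ → ℝ := fun c => |c.re| + |c.im| with hN
  have hle : ∀ c : ℂ, ‖c‖ ≤ N c := Complex.norm_le_abs_re_add_abs_im
  have hge : ∀ c : ℂ, N c ≤ 2 * ‖c‖ := fun c => by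
    have := Complex.abs_re_le_norm c
    have := Complex.abs_im_le_norm c
    simp only [hN]; linarith
  have hNc : Continuous N := by fun_prop
  have hsm : ∀ (k : ℝ) (c : ℂ), 0 ≤ k → N (k * c) = k * N c := fun k c hk => by
    simp [hN, abs_mul, abs_of_nonneg hk, mul_add]
  set r : unitInterval → ℂ → ℝ := fun t c => 1 - t + t * (N c / ‖c‖) with hr
  have hrb : ∀ t c, c ≠ 0 → 1 ≤ r t c ∧ r t c ≤ 2 := by
    intro t c hc
    have hp : 0 < ‖c‖ := norm_pos_iff.2 hc
    have h1 : 1 ≤ N c / ‖c‖ := (one_le_div hp).2 (hle c)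
    have h2 : N c / ‖c‖ ≤ 2 := (div_le_iff₀ hp).2 (hge c)
    have h0 := t.2.1
    have h3 := t.2.2
    constructor <;> simp only [hr] <;> nlinarith
  -- The factor is constant along rays, so multiplication by `r` is inverted by division by the same
  -- factor.
  have hrs : ∀ t (k : ℝ) c, 0 < k → r t (k * c) = r t c := by
    intro t k c hk
    simp only [hr]
    rw [hsm k c hk.le, norm_mul, Complex.norm_real, Real.norm_of_nonneg hk.le,
      mul_div_mul_left _ _ hk.ne']
  have hrc : ∀ p : unitInterval × ℂ, p.2 ≠ 0 →
      ContinuousAt (fun p : unitInterval × ℂ => r p.1 p.2) p := by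
    intro p hp
    have : ContinuousAt (fun p : unitInterval × ℂ => N p.2 / ‖p.2‖) p :=
      ContinuousAt.div (by fun_prop) (by fun_prop) (norm_ne_zero_iff.2 hp)
    have h2 : ContinuousAt (fun p : unitInterval × ℂ => (p.1 : ℝ)) p := by fun_prop
    exact (continuousAt_const.sub h2).add (h2.mul this)
  -- The factor need not be continuous at the origin; its boundedness makes the product with `c`
  -- continuous there.
  have hcont : ∀ φ : unitInterval → ℂ → ℝ,
      (∀ p : unitInterval × ℂ, p.2 ≠ 0 → ContinuousAt (fun p : unitInterval × ℂ => φ p.1 p.2) p) →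
      (∀ t c, c ≠ 0 → |φ t c| ≤ 2) →
      Continuous fun p : unitInterval × ℂ => (φ p.1 p.2 : ℂ) * p.2 := by
    intro φ h1 h2
    rw [continuous_iff_continuousAt]
    rintro ⟨t, c⟩
    by_cases hc : c = 0
    · subst hc
      unfold ContinuousAt
      simp only [mul_zero]
      refine squeeze_zero_norm (a := fun p : unitInterval × ℂ => 2 * ‖p.2‖) ?_ ?_
      · rintro ⟨s, c⟩
        by_cases hc : c = 0
        · simp [hc]
        · rw [norm_mul, Complex.norm_real]
          exact mul_le_mul_of_nonneg_right (h2 s c hc) (norm_nonneg _)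
      · have : Continuous fun p : unitInterval × ℂ => 2 * ‖p.2‖ := by fun_prop
        simpa using this.tendsto (t, 0)
    · have := h1 (t, c) hc
      have h3 : ContinuousAt (fun p : unitInterval × ℂ => (φ p.1 p.2 : ℂ)) (t, c) :=
        Complex.continuous_ofReal.continuousAt.comp this
      exact h3.mul continuousAt_snd
  have c1 := hcont r hrc (fun t c hc => by
    rw [abs_of_nonneg (by linarith [(hrb t c hc).1])]; exact (hrb t c hc).2)
  have c2 := hcont (fun t c => (r t c)⁻¹)
    (fun p hp => (hrc p hp).inv₀ (by linarith [(hrb p.1 p.2 hp).1])) (fun t c hc => by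
    have := (hrb t c hc).1
    rw [abs_of_nonneg (by positivity)]
    exact (inv_le_one_of_one_le₀ this).trans one_le_two)
  refine Isotopic.of_maps (fun t p => ((r t p.1 : ℂ) * p.1, p.2))
    (fun t p => (((r t p.1)⁻¹ : ℝ) * p.1, p.2)) ?_ ?_ ?_ ?_ ?_ ?_
  · exact (c1.comp (continuous_fst.prodMk (continuous_fst.comp continuous_snd))).prodMk
      (continuous_snd.comp continuous_snd)
  · exact (c2.comp (continuous_fst.prodMk (continuous_fst.comp continuous_snd))).prodMk
      (continuous_snd.comp continuous_snd)
  · rintro t ⟨c, z⟩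
    by_cases hc : c = 0
    · simp [hc]
    · have h := (hrb t c hc).1
      have h' : (r t c : ℂ) ≠ 0 := by exact_mod_cast (by linarith : r t c ≠ 0)
      simp only [hrs t _ c (by linarith : 0 < r t c), Prod.mk.injEq, and_true]
      push_cast
      exact inv_mul_cancel_left₀ h' _
  · rintro t ⟨c, z⟩
    by_cases hc : c = 0
    · simp [hc]
    · have h := (hrb t c hc).1
      have h' : (r t c : ℂ) ≠ 0 := by exact_mod_cast (by linarith : r t c ≠ 0)
      simp only [hrs t _ c (inv_pos.2 (by linarith : 0 < r t c)), Prod.mk.injEq, and_true]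
      push_cast
      exact mul_inv_cancel_left₀ h' _
  · rintro ⟨c, z⟩; simp [hr]
  · ext ⟨c, z⟩
    simp only [Set.mem_image, horizontalSquare, horizontalCircle, Set.mem_ofPred_eq, Prod.exists,
      Prod.mk.injEq]
    constructor
    · rintro ⟨y, w, ⟨h1, h2⟩, h3, h4⟩
      refine ⟨by rw [← h4, h1], ?_⟩
      have hy : y ≠ 0 := by rintro rfl; simp at h2
      have h5 : N y = 1 := h2
      have : ‖y‖ ≠ 0 := norm_ne_zero_iff.2 hy
      rw [← h3, norm_mul, Complex.norm_real]
      simp only [hr, h5]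
      simp [this]
    · rintro ⟨h1, h2⟩
      have hc : c ≠ 0 := by rintro rfl; simp at h2
      have hNp : 0 < N c := by linarith [hle c]
      refine ⟨((N c)⁻¹ : ℝ) * c, 0, ⟨rfl, ?_⟩, ?_, h1.symm⟩
      · change N (((N c)⁻¹ : ℝ) * c) = 1
        rw [hsm _ _ (by positivity)]
        exact inv_mul_cancel₀ hNp.ne'
      · rw [hrs _ _ _ (by positivity)]
        simp only [hr, h2]
        simp
        exact mul_inv_cancel_left₀ (by exact_mod_cast hNp.ne') _

/-! ### Arcs that are graphs over the height -/

/-- `S` is the graph over the heights in `[lo, hi]` of a continuous function that is affine near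
both ends. -/
structure IsGraphArc (S : Set (ℂ × ℝ)) (A : ℝ → ℂ) (lo hi : ℝ) : Prop where
  lt : lo < hi
  continuous : Continuous A
  eq_image : S = (fun z => (A z, z)) '' Set.Icc lo hi
  bottom : ∃ ε > 0, ∃ v : ℂ, ∀ z, lo ≤ z → z ≤ lo + ε → A z = A lo + (z - lo : ℝ) * v
  top : ∃ ε > 0, ∃ v : ℂ, ∀ z, hi - ε ≤ z → z ≤ hi → A z = A hi + (hi - z : ℝ) * v

theorem isGraphArc_segment (p q : ℂ × ℝ) (h : p.2 < q.2) :
    IsGraphArc (segment ℝ p q)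
      (fun z => p.1 + ((z - p.2) / (q.2 - p.2) : ℝ) * (q.1 - p.1)) p.2 q.2 where
  lt := h
  continuous := by
    have : Continuous fun z : ℝ => (z - p.2) / (q.2 - p.2) := by fun_prop
    fun_prop
  eq_image := by
    have hd : 0 < q.2 - p.2 := sub_pos.2 h
    rw [segment_eq_image']
    ext ⟨c, z⟩
    simp only [Set.mem_image, Set.mem_Icc, Prod.mk.injEq]
    constructor
    · rintro ⟨t, ⟨h0, h1⟩, ht⟩
      have e1 := congrArg Prod.fst ht
      have e2 := congrArg Prod.snd ht
      simp at e1 e2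
      refine ⟨z, ⟨by nlinarith, by nlinarith⟩, ?_, rfl⟩
      have ht' : (p.2 + t * (q.2 - p.2) - p.2) / (q.2 - p.2) = t := by
        rw [add_sub_cancel_left, mul_div_cancel_right₀ _ hd.ne']
      rw [← e2, ← e1, ht']
    · rintro ⟨w, ⟨h0, h1⟩, h2, rfl⟩
      refine ⟨(w - p.2) / (q.2 - p.2), ⟨div_nonneg (by linarith) hd.le,
        (div_le_one hd).2 (by linarith)⟩, ?_⟩
      ext1
      · simp [← h2]
      · simp
        field_simp
        ring
  bottom := by
    refine ⟨1, one_pos, ((q.2 - p.2 : ℝ) : ℂ)⁻¹ * (q.1 - p.1), fun z _ _ => ?_⟩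
    simp [div_eq_mul_inv, mul_assoc]
  top := by
    have hd : ((q.2 - p.2 : ℝ) : ℂ) ≠ 0 := by exact_mod_cast (sub_pos.2 h).ne'
    refine ⟨1, one_pos, -((q.2 - p.2 : ℝ) : ℂ)⁻¹ * (q.1 - p.1), fun z _ _ => ?_⟩
    push_cast at hd ⊢
    field_simp
    ring

theorem IsGraphArc.union {S T : Set (ℂ × ℝ)} {A B : ℝ → ℂ} {lo mid hi : ℝ}
    (hS : IsGraphArc S A lo mid) (hT : IsGraphArc T B mid hi) (hAB : A mid = B mid) :
    IsGraphArc (S ∪ T) (fun z => if z ≤ mid then A z else B z) lo hi where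
  lt := hS.lt.trans hT.lt
  continuous := Continuous.if_le hS.continuous hT.continuous continuous_id continuous_const
    (fun z hz => by subst hz; exact hAB)
  eq_image := by
    have h1 := hS.lt
    have h2 := hT.lt
    rw [hS.eq_image, hT.eq_image, ← Set.Icc_union_Icc_eq_Icc h1.le h2.le, Set.image_union]
    congr 1
    · exact Set.image_congr fun z hz => by rw [if_pos hz.2]
    · refine Set.image_congr fun z hz => ?_
      split_ifs with h
      · rw [le_antisymm h hz.1, hAB]
      · rfl
  bottom := by
    obtain ⟨ε, hε, v, hv⟩ := hS.bottom
    have h1 := hS.lt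
    refine ⟨min ε (mid - lo), lt_min hε (sub_pos.2 h1), v, fun z hz hz' => ?_⟩
    rw [if_pos (by linarith [min_le_right ε (mid - lo)]), if_pos h1.le]
    exact hv z hz (by linarith [min_le_left ε (mid - lo)])
  top := by
    obtain ⟨ε, hε, v, hv⟩ := hT.top
    have h1 := hT.lt
    refine ⟨min ε (hi - mid), lt_min hε (sub_pos.2 h1), v, fun z hz hz' => ?_⟩
    have h3 := min_le_left ε (hi - mid)
    have h4 := min_le_right ε (hi - mid)
    rw [if_neg h1.not_ge]
    split_ifs with h
    · have : z = mid := by linarith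
      rw [this, hAB]
      exact hv mid (by linarith) h1.le
    · exact hv z (by linarith) hz'

theorem IsGraphArc.apply_eq {S : Set (ℂ × ℝ)} {A : ℝ → ℂ} {lo hi : ℝ} (hS : IsGraphArc S A lo hi)
    {p : ℂ × ℝ} (hp : p ∈ S) : A p.2 = p.1 := by
  rw [hS.eq_image] at hp
  obtain ⟨z, -, rfl⟩ := hp
  rfl

/-- A polygonal chain of strictly increasing height is a graph over the height. -/
theorem exists_isGraphArc_chain (P : ℕ → ℂ × ℝ) (m : ℕ) (h : ∀ k ≤ m, (P k).2 < (P (k + 1)).2) :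
    ∃ A, IsGraphArc (⋃ k ∈ Set.Iic m, segment ℝ (P k) (P (k + 1))) A (P 0).2 (P (m + 1)).2 := by
  induction m with
  | zero =>
    have : ⋃ k ∈ Set.Iic 0, segment ℝ (P k) (P (k + 1)) = segment ℝ (P 0) (P 1) := by
      ext x
      simp
    rw [this]
    exact ⟨_, isGraphArc_segment (P 0) (P 1) (h 0 le_rfl)⟩
  | succ m ih =>
    obtain ⟨A, hA⟩ := ih fun k hk => h k (by omega)
    have hB := isGraphArc_segment (P (m + 1)) (P (m + 1 + 1)) (h (m + 1) le_rfl)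
    have hset : ⋃ k ∈ Set.Iic (m + 1), segment ℝ (P k) (P (k + 1)) =
        (⋃ k ∈ Set.Iic m, segment ℝ (P k) (P (k + 1))) ∪
          segment ℝ (P (m + 1)) (P (m + 1 + 1)) := by
      ext x
      simp [Nat.le_succ_iff, or_and_right, exists_or]
    rw [hset]
    refine ⟨_, hA.union hB ?_⟩
    rw [hB.apply_eq (left_mem_segment ℝ _ _)]
    refine hA.apply_eq ?_
    simp only [Set.mem_iUnion]
    exact ⟨m, Set.mem_Iic.2 le_rfl, right_mem_segment ℝ _ _⟩

/-- The difference of two graph arcs with common ends and disjoint interiors is a nowhere vanishing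
function times the distance to the nearer end. -/
theorem IsGraphArc.exists_quotient {S T : Set (ℂ × ℝ)} {A B : ℝ → ℂ} {lo hi : ℝ}
    (hS : IsGraphArc S A lo hi) (hT : IsGraphArc T B lo hi) (hlo : A lo = B lo) (hhi : A hi = B hi)
    (hne : ∀ z, lo < z → z < hi → A z ≠ B z) :
    ∃ q : ℝ → ℂ, Continuous q ∧ (∀ z, q z ≠ 0) ∧
      ∀ z ∈ Set.Icc lo hi, B z = A z + (min (z - lo) (hi - z) : ℝ) * q z := by
  obtain ⟨ε₁, h₁, v₁, hv₁⟩ := hS.bottom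
  obtain ⟨ε₂, h₂, v₂, hv₂⟩ := hT.bottom
  obtain ⟨ε₃, h₃, v₃, hv₃⟩ := hS.top
  obtain ⟨ε₄, h₄, v₄, hv₄⟩ := hT.top
  have hlt := hS.lt
  obtain ⟨ε, hε, e1, e2, e3, e4, e5⟩ : ∃ ε > 0, ε ≤ ε₁ ∧ ε ≤ ε₂ ∧ ε ≤ ε₃ ∧ ε ≤ ε₄ ∧
      ε ≤ (hi - lo) / 3 := by
    refine ⟨min (min (min ε₁ ε₂) (min ε₃ ε₄)) ((hi - lo) / 3), ?_, ?_, ?_, ?_, ?_, ?_⟩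
    · have : 0 < (hi - lo) / 3 := by linarith
      simp only [gt_iff_lt, lt_min_iff]
      tauto
    all_goals simp
  -- Within `ε` of an end, inside the interval, both arcs are affine with a common endpoint, so
  -- their difference over the distance to that end is constant. Clamping `z` to `[lo + ε, hi - ε]`
  -- therefore extends the quotient continuously, and without zeros, to the whole line.
  set c : ℝ → ℝ := fun z => max (lo + ε) (min z (hi - ε)) with hc
  have hc1 : ∀ z, lo + ε ≤ c z := fun z => le_max_left _ _
  have hc2 : ∀ z, c z ≤ hi - ε := fun z => max_le (by linarith) (min_le_right _ _)
  set τ : ℝ → ℝ := fun z => min (z - lo) (hi - z) with hτ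
  have hτ0 : ∀ z, 0 < τ (c z) := fun z =>
    lt_min (by linarith [hc1 z]) (by linarith [hc2 z])
  have hτ0' : ∀ z, (τ (c z) : ℂ) ≠ 0 := fun z => by exact_mod_cast (hτ0 z).ne'
  have hA := hS.continuous
  have hB := hT.continuous
  have hcc : Continuous c := by fun_prop
  have hτc : Continuous τ := by fun_prop
  refine ⟨fun z => (B (c z) - A (c z)) / τ (c z), ?_, ?_, ?_⟩
  · refine Continuous.div ?_ ?_ hτ0' <;> fun_prop
  · intro z
    refine div_ne_zero (sub_ne_zero.2 (hne _ ?_ ?_).symm) (hτ0' z)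
    · linarith [hc1 z]
    · linarith [hc2 z]
  · rintro z ⟨hz0, hz1⟩
    change B z = A z + (τ z : ℂ) * ((B (c z) - A (c z)) / τ (c z))
    rcases le_total z (lo + ε) with hz | hz
    · have e : c z = lo + ε := by
        simp only [hc]
        exact max_eq_left ((min_le_left _ _).trans hz)
      have t1 : τ (lo + ε) = ε := by
        simp only [hτ]
        rw [min_eq_left] <;> linarith
      have t2 : τ z = z - lo := by
        simp only [hτ]
        rw [min_eq_left]; linarith
      have hε' : (ε : ℂ) ≠ 0 := by exact_mod_cast hε.ne'
      rw [e, t1, t2, hv₁ z hz0 (by linarith), hv₂ z hz0 (by linarith),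
        hv₁ (lo + ε) (by linarith) (by linarith), hv₂ (lo + ε) (by linarith) (by linarith), hlo]
      push_cast
      field_simp
      ring
    rcases le_total z (hi - ε) with hz' | hz'
    · have e : c z = z := by
        simp only [hc]
        rw [min_eq_left hz', max_eq_right hz]
      have := hτ0' z
      rw [e] at this ⊢
      field_simp
      ring
    · have e : c z = hi - ε := by
        simp only [hc]
        rw [min_eq_right hz', max_eq_right]; linarith
      have t1 : τ (hi - ε) = ε := by
        simp only [hτ]
        rw [min_eq_right] <;> linarith
      have t2 : τ z = hi - z := by
        simp only [hτ]
        rw [min_eq_right]; linarith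
      have hε' : (ε : ℂ) ≠ 0 := by exact_mod_cast hε.ne'
      rw [e, t1, t2, hv₃ z (by linarith) hz1, hv₄ z (by linarith) hz1,
        hv₃ (hi - ε) (by linarith) (by linarith), hv₄ (hi - ε) (by linarith) (by linarith), hhi]
      push_cast
      field_simp
      ring

/-- Two graph arcs with common ends and disjoint interiors form a trivial knot. -/
theorem IsGraphArc.isotopic_horizontalCircle {S T : Set (ℂ × ℝ)} {A B : ℝ → ℂ} {lo hi : ℝ}
    (hS : IsGraphArc S A lo hi) (hT : IsGraphArc T B lo hi) (hlo : A lo = B lo) (hhi : A hi = B hi)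
    (hne : ∀ z, lo < z → z < hi → A z ≠ B z) : Isotopic (S ∪ T) horizontalCircle := by
  obtain ⟨q, hq, hq0, hBq⟩ := hS.exists_quotient hT hlo hhi hne
  have hlt : 0 < hi - lo := sub_pos.2 hS.lt
  -- With `τ` the distance to the nearer end, division by `q` makes the difference of the arcs equal
  -- to `τ`. The translation then centres them at `-τ / 2` and `τ / 2`. The rescaling below sends
  -- the heights to `[-1, 1]` and the maximum `(hi - lo) / 4` of `τ / 2` to `1`.
  have h1 := isotopic_divide (S ∪ T) q
    (fun z => -(A z / q z) - ((min (z - lo) (hi - z) / 2 : ℝ) : ℂ)) hq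
    (((hS.continuous.div hq hq0).neg).sub (by fun_prop)) hq0
  refine h1.trans ((isotopic_rescale _ (k := 4 / (hi - lo)) (m := 2 / (hi - lo)) (by positivity)
    (by positivity) (-(lo + hi) / (hi - lo))).trans ?_)
  convert isotopic_verticalSquare_horizontalSquare.trans
    isotopic_horizontalSquare_horizontalCircle
  rw [hS.eq_image, hT.eq_image, Set.image_union, Set.image_union, Set.image_image,
    Set.image_image, Set.image_image, Set.image_image]
  have hτ : ∀ z, 4 / (hi - lo) * (min (z - lo) (hi - z) / 2) =
      1 - |2 / (hi - lo) * z + -(lo + hi) / (hi - lo)| := by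
    intro z
    have e : 2 / (hi - lo) * z + -(lo + hi) / (hi - lo) = (2 * z - (lo + hi)) / (hi - lo) := by
      ring
    rw [e, abs_div, abs_of_pos hlt]
    rcases le_total (z - lo) (hi - z) with h | h
    · rw [min_eq_left h, abs_of_nonpos (by linarith)]
      field_simp
      ring
    · rw [min_eq_right h, abs_of_nonneg (by linarith)]
      field_simp
      ring
  have hcA : ∀ z ∈ Set.Icc lo hi, (((4 / (hi - lo) : ℝ) : ℂ) * (A z / q z +
      (-(A z / q z) - ((min (z - lo) (hi - z) / 2 : ℝ) : ℂ)))) =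
      ((-(1 - |2 / (hi - lo) * z + -(lo + hi) / (hi - lo)|) : ℝ) : ℂ) := by
    intro z hz
    rw [← hτ z]
    push_cast
    ring
  have hcB : ∀ z ∈ Set.Icc lo hi, (((4 / (hi - lo) : ℝ) : ℂ) * (B z / q z +
      (-(A z / q z) - ((min (z - lo) (hi - z) / 2 : ℝ) : ℂ)))) =
      ((1 - |2 / (hi - lo) * z + -(lo + hi) / (hi - lo)| : ℝ) : ℂ) := by
    intro z hz
    rw [← hτ z, hBq z hz]
    have := hq0 z
    push_cast
    field_simp
    ring
  ext ⟨c, z⟩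
  simp only [Set.mem_union, Set.mem_image, verticalSquare, Set.mem_ofPred_eq, Prod.mk.injEq]
  have hrange : ∀ w, w ∈ Set.Icc lo hi → |2 / (hi - lo) * w + -(lo + hi) / (hi - lo)| ≤ 1 := by
    rintro w ⟨hw0, hw1⟩
    have := hτ w
    have h2 : 0 ≤ 4 / (hi - lo) * (min (w - lo) (hi - w) / 2) := by
      have : 0 ≤ min (w - lo) (hi - w) := le_min (by linarith) (by linarith)
      positivity
    linarith
  constructor
  · rintro (⟨w, hw, h2, h3⟩ | ⟨w, hw, h2, h3⟩)
    · have hr := hrange w hw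
      rw [hcA w hw, h3] at h2
      rw [h3] at hr
      rw [← h2]
      refine ⟨Complex.ofReal_im _, ?_⟩
      rw [Complex.ofReal_re, abs_neg, abs_of_nonneg (by linarith)]
      ring
    · have hr := hrange w hw
      rw [hcB w hw, h3] at h2
      rw [h3] at hr
      rw [← h2]
      refine ⟨Complex.ofReal_im _, ?_⟩
      rw [Complex.ofReal_re, abs_of_nonneg (by linarith)]
      ring
  · rintro ⟨h2, h3⟩
    have hz : |z| ≤ 1 := by linarith [abs_nonneg c.re]
    obtain ⟨hz0, hz1⟩ := abs_le.1 hz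
    have hw : ((hi - lo) * z + (lo + hi)) / 2 ∈ Set.Icc lo hi := by
      constructor <;> nlinarith
    have hwz : 2 / (hi - lo) * (((hi - lo) * z + (lo + hi)) / 2) + -(lo + hi) / (hi - lo) = z := by
      field_simp
      ring
    rcases le_total 0 c.re with hre | hre
    · refine Or.inr ⟨_, hw, ?_, hwz⟩
      rw [hcB _ hw, hwz]
      apply Complex.ext
      · rw [abs_of_nonneg hre] at h3
        rw [Complex.ofReal_re]
        linarith
      · rw [Complex.ofReal_im, h2]
    · refine Or.inl ⟨_, hw, ?_, hwz⟩
      rw [hcA _ hw, hwz]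
      apply Complex.ext
      · rw [abs_of_nonpos hre] at h3
        rw [Complex.ofReal_re]
        linarith
      · rw [Complex.ofReal_im, h2]

/-! ### Tilted coordinates -/

/-- Euclidean space as the product of the complex plane and the line of heights. -/
noncomputable def spaceHomeomorph : Space ≃ₜ ℂ × ℝ where
  toFun x := (⟨x 0, x 1⟩, x 2)
  invFun p := !₂[p.1.re, p.1.im, p.2]
  left_inv x := by
    ext i
    fin_cases i <;> rfl
  right_inv p := rfl
  continuous_toFun := by
    simp only [Complex.mk_eq_add_mul_I]
    fun_prop
  continuous_invFun := by
    refine (PiLp.continuous_toLp 2 _).comp (continuous_pi fun i => ?_)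
    fin_cases i
    · exact Complex.continuous_re.comp continuous_fst
    · exact Complex.continuous_im.comp continuous_fst
    · exact continuous_snd

theorem spaceHomeomorph_image_standardCircle :
    spaceHomeomorph '' standardCircle = horizontalCircle := by
  ext ⟨c, z⟩
  have hn : ‖c‖ = 1 ↔ c.re ^ 2 + c.im ^ 2 = 1 := by
    rw [← sq_eq_sq₀ (norm_nonneg c) zero_le_one, Complex.sq_norm, Complex.normSq_apply]
    simp only [sq, one_mul]
  simp only [horizontalCircle, Set.mem_ofPred_eq, hn]
  constructor
  · rintro ⟨x, ⟨h1, h2⟩, h3⟩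
    obtain ⟨rfl, rfl⟩ := Prod.mk.inj h3
    exact ⟨h2, h1⟩
  · rintro ⟨h1, h2⟩
    exact ⟨!₂[c.re, c.im, z], ⟨h2, h1⟩, rfl⟩

/-- Coordinates on Euclidean space in which `a x₀ + b x₁ + x₂` is the height. -/
noncomputable def tiltedCoordinates (a b : ℝ) : Space →ₗ[ℝ] ℂ × ℝ where
  toFun x := (⟨x 0, x 1⟩, x 2 + (a * x 0 + b * x 1))
  map_add' x y := by
    ext1
    · apply Complex.ext <;> simp
    · simp; ring
  map_smul' r x := by
    ext1
    · apply Complex.ext <;> simp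
    · simp; ring

theorem tiltedCoordinates_injective (a b : ℝ) : Function.Injective (tiltedCoordinates a b) := by
  intro x y h
  obtain ⟨h1, h2⟩ := Prod.mk.inj h
  obtain ⟨h3, h4⟩ := Complex.mk.inj h1
  rw [h3, h4] at h2
  ext i
  fin_cases i
  · exact h3
  · exact h4
  · exact add_right_cancel h2

/-- Tilting is a vertical shear, hence itself an ambient isotopy. -/
theorem isUnknot_of_tilted_isotopic {K : Set Space} (a b : ℝ)
    (h : Isotopic (tiltedCoordinates a b '' K) horizontalCircle) : IsUnknot K := by
  refine Isotopic.conj spaceHomeomorph ?_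
  rw [spaceHomeomorph_image_standardCircle]
  refine (isotopic_shear _ (fun c => a * c.re + b * c.im) (by fun_prop)).trans ?_
  rw [Set.image_image]
  exact h

/-! ### Polygons with a single local maximum -/

section PeriodicVertices

variable {n : ℕ} [NeZero n]

/-- The vertices of the polygon with edges `w`, indexed periodically. -/
noncomputable def vertex (w : Fin n → Space) (k : ℕ) : Space :=
  ∑ i ∈ Finset.range k, w (Fin.ofNat n i)

theorem vertex_succ (w : Fin n → Space) (k : ℕ) :
    vertex w (k + 1) = vertex w k + w (Fin.ofNat n k) :=
  Finset.sum_range_succ _ _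

theorem tail_eq_vertex (w : Fin n → Space) (k : Fin n) : tail w k = vertex w k := by
  rw [tail, vertex]
  symm
  refine Finset.sum_bij' (fun i _ => Fin.ofNat n i) (fun i _ => (i : ℕ)) ?_ ?_ ?_ ?_ ?_
  · intro i hi
    have := Finset.mem_range.1 hi
    rw [Finset.mem_Iio, Fin.lt_def]
    simpa [Nat.mod_eq_of_lt (this.trans k.2)] using this
  · intro i hi
    exact Finset.mem_range.2 (Fin.lt_def.1 (Finset.mem_Iio.1 hi))
  · intro i hi
    have := Finset.mem_range.1 hi
    simp [Nat.mod_eq_of_lt (this.trans k.2)]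
  · intro i hi
    simp
  · intro i hi
    rfl

theorem vertex_add_period {w : Fin n → Space} (h : ∑ i, w i = 0) (k : ℕ) :
    vertex w (k + n) = vertex w k := by
  induction k with
  | zero =>
    rw [zero_add, vertex, ← Fin.sum_univ_eq_sum_range (fun i => w (Fin.ofNat n i))]
    simpa [vertex] using h
  | succ k ih =>
    rw [add_right_comm, vertex_succ, vertex_succ, ih]
    congr 2
    simp [Fin.ext_iff]

theorem vertex_mod {w : Fin n → Space} (h : ∑ i, w i = 0) (k : ℕ) :
    vertex w (k % n) = vertex w k := by
  have : Function.Periodic (vertex w) n := vertex_add_period h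
  exact this.map_mod_nat k

theorem vertex_eq_tail {w : Fin n → Space} (h : ∑ i, w i = 0) (k : ℕ) :
    vertex w k = tail w (Fin.ofNat n k) := by
  rw [tail_eq_vertex, Fin.val_ofNat, vertex_mod h]

/-- Closedness lets the curve be read from any starting vertex, so that each of the two monotone
arcs becomes an interval of indices. -/
theorem polygonalCurve_eq {w : Fin n → Space} (h : ∑ i, w i = 0) (s : ℕ) :
    polygonalCurve w =
      ⋃ k ∈ Set.Ico s (s + n), segment ℝ (vertex w k) (vertex w (k + 1)) := by
  have hseg : ∀ k, segment ℝ (vertex w k) (vertex w (k + 1)) =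
      segment ℝ (tail w (Fin.ofNat n k)) (tail w (Fin.ofNat n k) + w (Fin.ofNat n k)) := by
    intro k
    rw [vertex_succ, vertex_eq_tail h]
  ext x
  simp only [polygonalCurve, Set.mem_iUnion, hseg, exists_prop]
  constructor
  · rintro ⟨i, hi⟩
    obtain ⟨k, hk, hki⟩ : ∃ k ∈ Set.Ico s (s + n), Fin.ofNat n k = i := by
      have := Nat.image_Ico_mod s n ▸ Finset.mem_range.2 i.2
      obtain ⟨k, hk, hki⟩ := Finset.mem_image.1 this
      exact ⟨k, Finset.mem_Ico.1 hk, Fin.ext hki⟩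
    exact ⟨k, hk, hki ▸ hi⟩
  · rintro ⟨k, -, hk⟩
    exact ⟨_, hk⟩

theorem IsSimpleClosed.mod_eq_of_add_smul_eq {w : Fin n → Space} (h : IsSimpleClosed w)
    {i j : ℕ} {t u : ℝ}
    (ht : t ∈ Set.Ico (0 : ℝ) 1) (hu : u ∈ Set.Ico (0 : ℝ) 1)
    (heq : vertex w i + t • w (Fin.ofNat n i) = vertex w j + u • w (Fin.ofNat n j)) :
    i % n = j % n := by
  rw [vertex_eq_tail h.1, vertex_eq_tail h.1] at heq
  have := @h.2 (Fin.ofNat n i, ⟨t, ht⟩) (Fin.ofNat n j, ⟨u, hu⟩) heq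
  have := congrArg (fun p => (p.1 : ℕ)) this
  simpa using this

/-- Simplicity is stated for half-open edges. A point at the tip of an edge is moved to the tail of
the next one, which stays in range unless it is the final vertex. -/
theorem exists_mem_Ico_of_mem_segment (w : Fin n → Space) {a b k : ℕ} (hk : k ∈ Set.Ico a b)
    {x : Space} (hx : x ∈ segment ℝ (vertex w k) (vertex w (k + 1))) (hxb : x ≠ vertex w b) :
    ∃ j ∈ Set.Ico a b, ∃ t ∈ Set.Ico (0 : ℝ) 1, x = vertex w j + t • w (Fin.ofNat n j) := by
  rw [segment_eq_image'] at hx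
  obtain ⟨t, ⟨h0, h1⟩, rfl⟩ := hx
  have e : vertex w (k + 1) - vertex w k = w (Fin.ofNat n k) := by
    rw [vertex_succ, add_sub_cancel_left]
  simp only [e] at hxb ⊢
  rcases h1.lt_or_eq with h | rfl
  · exact ⟨k, hk, t, ⟨h0, h⟩, rfl⟩
  · rw [one_smul, ← vertex_succ] at hxb ⊢
    have : k + 1 ≠ b := fun h => hxb (by rw [h])
    exact ⟨k + 1, ⟨by have := hk.1; omega, by have := hk.2; omega⟩, 0, by simp, by simp⟩

/-- A simple closed polygon on which some linear functional has a single local maximum is a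
trivial knot. -/
theorem IsSimpleClosed.isUnknot_of_unimodal {w : Fin n → Space} (h : IsSimpleClosed w) (a b : ℝ)
    (s m : ℕ) (hm : 0 < m) (hmn : m < n)
    (hpos : ∀ k, s ≤ k → k < s + m →
      0 < w (Fin.ofNat n k) 2 + (a * w (Fin.ofNat n k) 0 + b * w (Fin.ofNat n k) 1))
    (hneg : ∀ k, s + m ≤ k → k < s + n →
      w (Fin.ofNat n k) 2 + (a * w (Fin.ofNat n k) 0 + b * w (Fin.ofNat n k) 1) < 0) :
    IsUnknot (polygonalCurve w) := by
  refine isUnknot_of_tilted_isotopic a b ?_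
  set F := tiltedCoordinates a b with hF
  have hFinj := tiltedCoordinates_injective a b
  have hseg : ∀ x y, F '' segment ℝ x y = segment ℝ (F x) (F y) :=
    image_segment ℝ F.toAffineMap
  have hstep : ∀ k, (F (vertex w (k + 1))).2 = (F (vertex w k)).2 +
      (w (Fin.ofNat n k) 2 + (a * w (Fin.ofNat n k) 0 + b * w (Fin.ofNat n k) 1)) := by
    intro k
    rw [vertex_succ, map_add]
    rfl
  obtain ⟨A, hA⟩ := exists_isGraphArc_chain (fun k => F (vertex w (s + k))) (m - 1) (by
    intro k hk
    have := hstep (s + k)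
    have := hpos (s + k) (by omega) (by omega)
    change (F (vertex w (s + k))).2 < (F (vertex w (s + k + 1))).2
    linarith)
  -- The descending arc is traversed backwards, from vertex `s + n` down to `s + m`, so that it too
  -- rises from the common minimum.
  obtain ⟨B, hB⟩ := exists_isGraphArc_chain (fun k => F (vertex w (s + n - k))) (n - m - 1) (by
    intro k hk
    have h1 := hstep (s + n - (k + 1))
    have h2 := hneg (s + n - (k + 1)) (by omega) (by omega)
    rw [show s + n - (k + 1) + 1 = s + n - k by omega] at h1
    change (F (vertex w (s + n - k))).2 < (F (vertex w (s + n - (k + 1)))).2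
    linarith)
  set S := ⋃ k ∈ Set.Iic (m - 1),
    segment ℝ (F (vertex w (s + k))) (F (vertex w (s + (k + 1)))) with hS
  set T := ⋃ k ∈ Set.Iic (n - m - 1),
    segment ℝ (F (vertex w (s + n - k))) (F (vertex w (s + n - (k + 1)))) with hT
  have hS' : S = F '' ⋃ k ∈ Set.Ico s (s + m), segment ℝ (vertex w k) (vertex w (k + 1)) := by
    simp only [hS, Set.image_iUnion, hseg]
    ext x
    simp only [Set.mem_iUnion, exists_prop]
    constructor
    · rintro ⟨k, hk, hx⟩
      exact ⟨s + k, ⟨by omega, by have := Set.mem_Iic.1 hk; omega⟩, hx⟩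
    · rintro ⟨k, ⟨hk, hk'⟩, hx⟩
      refine ⟨k - s, Set.mem_Iic.2 (by omega), ?_⟩
      rwa [show s + (k - s + 1) = k + 1 by omega, show s + (k - s) = k by omega]
  have hT' : T = F '' ⋃ k ∈ Set.Ico (s + m) (s + n), segment ℝ (vertex w k) (vertex w (k + 1)) := by
    simp only [hT, Set.image_iUnion, hseg]
    ext x
    simp only [Set.mem_iUnion, exists_prop]
    constructor
    · rintro ⟨k, hk, hx⟩
      have := Set.mem_Iic.1 hk
      refine ⟨s + n - (k + 1), ⟨by omega, by omega⟩, ?_⟩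
      rwa [show s + n - (k + 1) + 1 = s + n - k by omega, segment_symm]
    · rintro ⟨k, ⟨hk, hk'⟩, hx⟩
      refine ⟨s + n - (k + 1), Set.mem_Iic.2 (by omega), ?_⟩
      rwa [show s + n - (s + n - (k + 1)) = k + 1 by omega,
        show s + n - (s + n - (k + 1) + 1) = k by omega, segment_symm]
  have hK : F '' polygonalCurve w = S ∪ T := by
    rw [polygonalCurve_eq h.1 s, hS', hT', ← Set.image_union, ← Set.biUnion_union,
      Set.Ico_union_Ico_eq_Ico (by omega) (by omega)]
  have hper := vertex_add_period h.1 s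
  simp only [add_zero, tsub_zero, hper, show s + n - (n - m - 1 + 1) = s + m by omega,
    show m - 1 + 1 = m by omega] at hA hB
  rw [hK]
  refine hA.isotopic_horizontalCircle hB ?_ ?_ ?_
  · have h1 : F (vertex w s) ∈ S := hS' ▸ Set.mem_image_of_mem F
      (Set.mem_biUnion ⟨le_rfl, by omega⟩ (left_mem_segment ℝ _ _))
    have h2 : F (vertex w s) ∈ T := by
      rw [hT', ← hper]
      refine Set.mem_image_of_mem F (Set.mem_biUnion (x := s + n - 1) ⟨by omega, by omega⟩ ?_)
      rw [show s + n - 1 + 1 = s + n by omega]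
      exact right_mem_segment ℝ _ _
    rw [hA.apply_eq h1, hB.apply_eq h2]
  · have h1 : F (vertex w (s + m)) ∈ S := by
      rw [hS']
      refine Set.mem_image_of_mem F (Set.mem_biUnion (x := s + m - 1) ⟨by omega, by omega⟩ ?_)
      rw [show s + m - 1 + 1 = s + m by omega]
      exact right_mem_segment ℝ _ _
    have h2 : F (vertex w (s + m)) ∈ T := hT' ▸ Set.mem_image_of_mem F
      (Set.mem_biUnion ⟨le_rfl, by omega⟩ (left_mem_segment ℝ _ _))
    rw [hA.apply_eq h1, hB.apply_eq h2]
  -- A common interior point would lie on half-open edges `i < j` with indices in `[s, s + n)`,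
  -- which cannot agree modulo `n`.
  · intro z hz0 hz1 hAB
    have h1 : (A z, z) ∈ S := by
      rw [hA.eq_image]
      exact Set.mem_image_of_mem _ ⟨hz0.le, hz1.le⟩
    have h2 : (A z, z) ∈ T := by
      rw [hB.eq_image, hAB]
      exact Set.mem_image_of_mem (fun z => (B z, z)) ⟨hz0.le, hz1.le⟩
    rw [hS'] at h1
    rw [hT'] at h2
    obtain ⟨x, hx, hxz⟩ := h1
    obtain ⟨y, hy, hyz⟩ := h2
    obtain rfl : x = y := hFinj (hxz.trans hyz.symm)
    have hxz2 : (F x).2 = z := by rw [hxz]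
    simp only [Set.mem_iUnion] at hx hy
    obtain ⟨i, hi, hxi⟩ := hx
    obtain ⟨j, hj, hxj⟩ := hy
    obtain ⟨i, hi, t, ht, hxi⟩ := exists_mem_Ico_of_mem_segment w hi hxi (by
      rintro rfl; exact hz1.ne hxz2.symm)
    obtain ⟨j, hj, u, hu, hxj⟩ := exists_mem_Ico_of_mem_segment w hj hxj (by
      rintro rfl; rw [hper] at hxz2; exact hz0.ne hxz2)
    have hmod := h.mod_eq_of_add_smul_eq ht hu (hxi.symm.trans hxj)
    have hlt : i < j := hi.2.trans_le hj.1
    have hdvd : n ∣ j - i := (Nat.modEq_iff_dvd' hlt.le).1 hmod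
    have := Nat.le_of_dvd (by omega) hdvd
    have := hi.1
    have := hj.2
    omega

end PeriodicVertices

/-! ### The four shapes of a cyclic word in the six directions -/

/-- A word whose first three letters are three successive directions, in some order. -/
def IsHalfSplit (d : Fin 6 → Fin 6) : Prop :=
  ∃ r : Fin 6, (d 0 - r < 3 ∧ d 1 - r < 3 ∧ d 2 - r < 3) ∧ 3 ≤ d 3 - r ∧ 3 ≤ d 4 - r ∧ 3 ≤ d 5 - r

/-- A word made of three pairs of opposite letters. -/
def IsSpoked (d : Fin 6 → Fin 6) : Prop :=
  d 1 = d 0 + 3 ∧ d 3 = d 2 + 3 ∧ d 5 = d 4 + 3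

/-- A word that starts with a pair of opposite letters, the remaining letters lying on the two
sides of their line in the order right, left, left, right. -/
def IsOneSpike (d : Fin 6 → Fin 6) : Prop :=
  d 1 = d 0 + 3 ∧ ∃ r : Fin 6, (d 0 = r ∨ d 0 = r + 3) ∧ 3 < d 2 - r ∧ (0 < d 3 - r ∧ d 3 - r < 3) ∧
    (0 < d 4 - r ∧ d 4 - r < 3) ∧ 3 < d 5 - r

/-- A word that runs around a triangle and then back. -/
def IsDoubledTriangle (d : Fin 6 → Fin 6) : Prop :=
  (d 3 = d 2 + 3 ∧ d 4 = d 1 + 3 ∧ d 5 = d 0 + 3) ∧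
    (d 1 = d 0 + 2 ∧ d 2 = d 0 + 4 ∨ d 1 = d 0 + 4 ∧ d 2 = d 0 + 2)

instance : DecidablePred IsHalfSplit := fun _ => by unfold IsHalfSplit; infer_instance
instance : DecidablePred IsSpoked := fun _ => by unfold IsSpoked; infer_instance
instance : DecidablePred IsOneSpike := fun _ => by unfold IsOneSpike; infer_instance
instance : DecidablePred IsDoubledTriangle := fun _ => by unfold IsDoubledTriangle; infer_instance

/-- Some rotation of the word has one of the four shapes. -/
def HasForm (d : Fin 6 → Fin 6) : Prop :=
  ∃ s : Fin 6, IsHalfSplit (fun j => d (s + j)) ∨ IsSpoked (fun j => d (s + j)) ∨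
    IsOneSpike (fun j => d (s + j)) ∨ IsDoubledTriangle (fun j => d (s + j))

instance : DecidablePred HasForm := fun _ => by unfold HasForm; infer_instance

set_option synthInstance.maxSize 1000 in
set_option synthInstance.maxHeartbeats 200000 in
-- A finite check. The interleaved hypotheses prune repeated letters early, leaving 720 words.
theorem hasForm_aux : ∀ a b : Fin 6, b ∉ [a] → ∀ c, c ∉ [a, b] → ∀ d, d ∉ [a, b, c] →
    ∀ e, e ∉ [a, b, c, d] → ∀ f, f ∉ [a, b, c, d, e] → HasForm ![a, b, c, d, e, f] := by
  decide +kernel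

theorem hasForm_of_injective (d : Fin 6 → Fin 6) (hd : Function.Injective d) : HasForm d := by
  have h := hasForm_aux (d 0) (d 1) (by simp [hd.eq_iff]) (d 2) (by simp [hd.eq_iff])
    (d 3) (by simp [hd.eq_iff]) (d 4) (by simp [hd.eq_iff]) (d 5) (by simp [hd.eq_iff])
  convert h
  funext i
  fin_cases i <;> rfl

/-! ### Linear functionals on the edges of a hexagon -/

/-- First coordinates of the six edges of a regular hexagon in the basis of two successive ones. -/
def hexX : Fin 6 → ℝ := ![1, 0, -1, -1, 0, 1]

/-- Second coordinates of the six edges of a regular hexagon in the basis of two successive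
ones. -/
def hexY : Fin 6 → ℝ := ![0, 1, 1, 0, -1, -1]

/-- The values of a linear functional on the six edges of a regular hexagon. -/
def IsHexForm (g : Fin 6 → ℝ) : Prop := ∃ x y : ℝ, ∀ k, g k = x * hexX k + y * hexY k

/-- The linear functional with given values on the edges `r` and `r + 1`. -/
def hexForm (r : Fin 6) (u v : ℝ) (k : Fin 6) : ℝ := u * hexX (k - r) + v * hexY (k - r)

theorem isHexForm_hexForm (r : Fin 6) (u v : ℝ) : IsHexForm (hexForm r u v) := by
  refine ⟨hexForm r u v 0, hexForm r u v 1, fun k => ?_⟩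
  fin_cases r <;> fin_cases k <;> simp [hexForm, hexX, hexY] <;> ring

theorem IsHexForm.neg {g : Fin 6 → ℝ} (h : IsHexForm g) : IsHexForm (fun k => -g k) := by
  obtain ⟨x, y, h⟩ := h
  exact ⟨-x, -y, fun k => by simp only [h]; ring⟩

theorem IsHexForm.add_three {g : Fin 6 → ℝ} (h : IsHexForm g) (k : Fin 6) : g (k + 3) = -g k := by
  obtain ⟨x, y, h⟩ := h
  rw [h, h]
  fin_cases k <;> simp [hexX, hexY, add_comm]

theorem hex_cross_ne_zero {i j : Fin 6} (h : j ≠ i) (h' : j ≠ i + 3) :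
    hexX i * hexY j - hexX j * hexY i ≠ 0 := by
  fin_cases i <;> fin_cases j <;> simp [hexX, hexY] at h h' ⊢

/-- A linear functional is determined by its values on two independent edges, and its value on a
third one depends on the first of them. -/
theorem exists_isHexForm {i j k : Fin 6} (hij : j ≠ i) (hij' : j ≠ i + 3) (hjk : j ≠ k)
    (hjk' : j ≠ k + 3) :
    ∃ a b : ℝ, a ≠ 0 ∧ ∀ x y, ∃ g, IsHexForm g ∧ g i = x ∧ g j = y ∧ g k = a * x + b * y := by
  have h1 := hex_cross_ne_zero hij hij'
  have h2 := hex_cross_ne_zero hjk hjk'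
  refine ⟨(hexX k * hexY j - hexX j * hexY k) / (hexX i * hexY j - hexX j * hexY i),
    (hexX i * hexY k - hexX k * hexY i) / (hexX i * hexY j - hexX j * hexY i),
    div_ne_zero h2 h1, fun x y => ?_⟩
  refine ⟨fun l => (x * hexY j - y * hexY i) / (hexX i * hexY j - hexX j * hexY i) * hexX l +
    (y * hexX i - x * hexX j) / (hexX i * hexY j - hexX j * hexY i) * hexY l,
    ⟨_, _, fun _ => rfl⟩, ?_, ?_, ?_⟩
  all_goals
    beta_reduce
    rw [div_mul_eq_mul_div, div_mul_eq_mul_div, ← add_div, div_eq_iff h1]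
    try rw [div_mul_eq_mul_div, div_mul_eq_mul_div, ← add_div, div_mul_cancel₀ _ h1]
    ring

theorem exists_mem_Ioo_ne_ne {a b : ℝ} (h : a < b) (u v : ℝ) : ∃ x ∈ Set.Ioo a b, x ≠ u ∧ x ≠ v := by
  obtain ⟨x, hx, hx'⟩ := (Set.Ioo_infinite h).exists_notMem_finset {u, v}
  simp only [Finset.mem_insert, Finset.mem_singleton, not_or] at hx'
  exact ⟨x, hx, hx'⟩

/-! ### Tilts for the four shapes -/

/-- The heights `z` can be tilted by a linear functional of the directions `D` so that the signs
of the slopes form one positive and one negative block. -/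
def IsTiltable (D : ℕ → Fin 6) (z : ℕ → ℝ) : Prop :=
  ∃ g, IsHexForm g ∧ ∃ s m, 0 < m ∧ m < 6 ∧ (∀ k, s ≤ k → k < s + m → 0 < g (D k) + z k) ∧
    ∀ k, s + m ≤ k → k < s + 6 → g (D k) + z k < 0

theorem IsTiltable.of_shift {D : ℕ → Fin 6} {z : ℕ → ℝ} (t : ℕ)
    (h : IsTiltable (fun k => D (t + k)) (fun k => z (t + k))) : IsTiltable D z := by
  obtain ⟨g, hg, s, m, h0, h1, h2, h3⟩ := h
  refine ⟨g, hg, t + s, m, h0, h1, fun k hk hk' => ?_, fun k hk hk' => ?_⟩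
  · have := h2 (k - t) (by omega) (by omega)
    simpa only [show t + (k - t) = k by omega] using this
  · have := h3 (k - t) (by omega) (by omega)
    simpa only [show t + (k - t) = k by omega] using this

theorem IsTiltable.of_neg {D : ℕ → Fin 6} {z : ℕ → ℝ} (hD : ∀ k, D (k + 6) = D k)
    (hz : ∀ k, z (k + 6) = z k) (h : IsTiltable D (fun k => -z k)) : IsTiltable D z := by
  obtain ⟨g, hg, s, m, h0, h1, h2, h3⟩ := h
  refine ⟨_, hg.neg, s + m, 6 - m, by omega, by omega, fun k hk hk' => ?_, fun k hk hk' => ?_⟩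
  · have := h3 k hk (by omega)
    linarith
  · have := h2 (k - 6) (by omega) (by omega)
    change 0 < g (D (k - 6)) + -z (k - 6) at this
    have e := hD (k - 6)
    have e' := hz (k - 6)
    rw [show k - 6 + 6 = k by omega] at e e'
    rw [← e, ← e'] at this
    linarith

/-- A line separates the first three directions from the last three, and a steep enough tilt across
it overrides all heights. -/
theorem isTiltable_of_isHalfSplit {D : ℕ → Fin 6} {z : ℕ → ℝ}
    (h : IsHalfSplit (fun j => D j)) : IsTiltable D z := by
  obtain ⟨r, ⟨h0, h1, h2⟩, h3, h4, h5⟩ := h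
  obtain ⟨N, hN⟩ : ∃ N, ∀ k < 6, |z k| < N := by
    refine ⟨∑ i ∈ Finset.range 6, |z i| + 1, fun k hk => ?_⟩
    have := Finset.single_le_sum (f := fun i => |z i|) (fun i _ => abs_nonneg _)
      (Finset.mem_range.2 hk)
    linarith
  have hN0 : 0 < N := (abs_nonneg _).trans_lt (hN 0 (by norm_num))
  -- The values on the edges `r, …, r + 5` are `N, 2N, N, -N, -2N, -N`.
  have hp : ∀ k : Fin 6, k - r < 3 → N ≤ hexForm r N (2 * N) k := by
    intro k hk
    unfold hexForm
    generalize k - r = j at hk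
    fin_cases j <;> simp [hexX, hexY] at hk ⊢ <;> linarith
  have hn : ∀ k : Fin 6, 3 ≤ k - r → hexForm r N (2 * N) k ≤ -N := by
    intro k hk
    unfold hexForm
    generalize k - r = j at hk
    fin_cases j <;> simp [hexX, hexY] at hk ⊢ <;> linarith
  refine ⟨_, isHexForm_hexForm r N (2 * N), 0, 3, by norm_num, by norm_num, ?_, ?_⟩
  · intro k _ hk
    have hz := (abs_lt.1 (hN k (by omega))).1
    have : N ≤ hexForm r N (2 * N) (D k) := by
      apply hp
      interval_cases k <;> assumption
    linarith
  · intro k hk hk'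
    have hz := (abs_lt.1 (hN k (by omega))).2
    have : hexForm r N (2 * N) (D k) ≤ -N := by
      apply hn
      interval_cases k <;> assumption
    linarith

/-- The component of the tilt along the opposite pair gives both its edges the slope `(z 0 + z 1) /
2`. A large transverse component `N` fixes the other signs: edges 3 and 4 positive, 2 and 5
negative. If the pair is negative it joins 5 and 2 into one block; otherwise all signs are reversed.
-/
theorem isTiltable_of_isOneSpike {D : ℕ → Fin 6} {z : ℕ → ℝ} (hD : ∀ k, D (k + 6) = D k)
    (hz : ∀ k, z (k + 6) = z k) (h : IsOneSpike (fun j => D j)) (hne : z 0 + z 1 ≠ 0) :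
    IsTiltable D z := by
  wlog hneg : z 0 + z 1 < 0 generalizing z
  · refine IsTiltable.of_neg hD hz (this (fun k => by rw [hz]) ?_ ?_)
    · intro h; apply hne; linarith
    · have := lt_of_le_of_ne (not_lt.1 hneg) hne.symm
      linarith
  obtain ⟨h1, r, h0, h2, h3, h4, h5⟩ := h
  change D 1 = D 0 + 3 at h1
  change D 0 = r ∨ D 0 = r + 3 at h0
  obtain ⟨x, hx⟩ : ∃ x : ℝ, ∀ N, hexForm r x N (D 0) = (z 1 - z 0) / 2 := by
    rcases h0 with h | h
    · refine ⟨(z 1 - z 0) / 2, fun N => ?_⟩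
      rw [h]
      simp [hexForm, hexX, hexY]
    · refine ⟨-((z 1 - z 0) / 2), fun N => ?_⟩
      rw [h]
      simp [hexForm, hexX, hexY]
  obtain ⟨N, hN⟩ : ∃ N, ∀ k < 6, |z k| + |x| < N := by
    refine ⟨∑ i ∈ Finset.range 6, |z i| + |x| + 1, fun k hk => ?_⟩
    have := Finset.single_le_sum (f := fun i => |z i|) (fun i _ => abs_nonneg _)
      (Finset.mem_range.2 hk)
    linarith
  have hx1 := neg_abs_le x
  have hx2 := le_abs_self x
  have hp : ∀ k : Fin 6, (0 < k - r ∧ k - r < 3) → N - |x| ≤ hexForm r x N k := by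
    intro k hk
    unfold hexForm
    generalize k - r = j at hk
    fin_cases j <;> simp [hexX, hexY] at hk ⊢ <;> linarith
  have hn : ∀ k : Fin 6, 3 < k - r → hexForm r x N k ≤ |x| - N := by
    intro k hk
    unfold hexForm
    generalize k - r = j at hk
    fin_cases j <;> simp [hexX, hexY] at hk ⊢ <;> linarith
  have hg := isHexForm_hexForm r x N
  refine ⟨_, hg, 3, 2, by norm_num, by norm_num, ?_, ?_⟩
  · intro k hk hk'
    have hz := neg_abs_le (z k)
    have := hN k (by omega)
    have : N - |x| ≤ hexForm r x N (D k) := by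
      apply hp
      interval_cases k <;> assumption
    linarith
  · intro k hk hk'
    have e0 := hx N
    have e1 := hg.add_three (D 0)
    rw [← h1] at e1
    have e2 := hn _ h2
    have e5 := hn _ h5
    have := hN 2 (by norm_num)
    have := hN 5 (by norm_num)
    have := le_abs_self (z 2)
    have := le_abs_self (z 5)
    change k < 9 at hk'
    change 5 ≤ k at hk
    interval_cases k
    · change hexForm r x N (D 5) ≤ _ at e5
      linarith
    · rw [hD 0, hz 0]; linarith
    · rw [hD 1, hz 1]; linarith
    · change hexForm r x N (D 2) ≤ _ at e2
      rw [hD 2, hz 2]; linarith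

/-- A tilt preserves the slope sum of an opposite pair. The first two pairs can be made positive
throughout. The third has negative sum, so at most one of its edges is positive, and either edge is
cyclically adjacent to the positive block. -/
theorem isTiltable_of_isSpoked_of_pos {D : ℕ → Fin 6} {z : ℕ → ℝ} (hD : ∀ k, D (k + 6) = D k)
    (hz : ∀ k, z (k + 6) = z k) (n0 : D 2 ≠ D 0) (n1 : D 2 ≠ D 1) (n4 : D 2 ≠ D 4) (n5 : D 2 ≠ D 5)
    (h1 : D 1 = D 0 + 3) (h3 : D 3 = D 2 + 3) (h5 : D 5 = D 4 + 3)
    (hz1 : 0 < z 0 + z 1) (hz3 : 0 < z 2 + z 3) (hz5 : z 4 + z 5 < 0) : IsTiltable D z := by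
  obtain ⟨a, b, ha, hg⟩ := exists_isHexForm (i := D 0) (j := D 2) (k := D 4)
    n0 (h1 ▸ n1) n4 (h5 ▸ n5)
  -- The interval keeps edges 0 and 1 positive. The two excluded values are those where edge 4 or
  -- edge 5 becomes horizontal; they are isolated because `a ≠ 0`.
  obtain ⟨x, ⟨hx0, hx1⟩, hxa, hxb⟩ := exists_mem_Ioo_ne_ne (show -z 0 < z 1 by linarith)
    ((-z 4 - b * ((z 3 - z 2) / 2)) / a) ((z 5 - b * ((z 3 - z 2) / 2)) / a)
  obtain ⟨g, hgh, g0, g2, g4⟩ := hg x ((z 3 - z 2) / 2)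
  have g1 := hgh.add_three (D 0)
  have g3 := hgh.add_three (D 2)
  have g5 := hgh.add_three (D 4)
  rw [← h1, g0] at g1
  rw [← h3, g2] at g3
  rw [← h5] at g5
  have n4 : g (D 4) + z 4 ≠ 0 := by
    intro h
    apply hxa
    rw [eq_div_iff ha]
    linarith
  have n5 : g (D 5) + z 5 ≠ 0 := by
    intro h
    apply hxb
    rw [eq_div_iff ha]
    linarith
  have p0 : 0 < g (D 0) + z 0 := by linarith
  have p1 : 0 < g (D 1) + z 1 := by linarith
  have p2 : 0 < g (D 2) + z 2 := by linarith
  have p3 : 0 < g (D 3) + z 3 := by linarith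
  rcases n4.lt_or_gt with l4 | l4
  · rcases n5.lt_or_gt with l5 | l5
    · refine ⟨g, hgh, 0, 4, by norm_num, by norm_num, fun k hk hk' => ?_, fun k hk hk' => ?_⟩ <;>
        simp only [Nat.reduceAdd] at hk hk' <;>
        (interval_cases k <;> assumption)
    · rw [← hD 0, ← hz 0] at p0
      rw [← hD 1, ← hz 1] at p1
      rw [← hD 2, ← hz 2] at p2
      rw [← hD 3, ← hz 3] at p3
      rw [← hD 4, ← hz 4] at l4
      refine ⟨g, hgh, 5, 5, by norm_num, by norm_num, fun k hk hk' => ?_, fun k hk hk' => ?_⟩ <;>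
        simp only [Nat.reduceAdd] at hk hk' <;>
        (interval_cases k <;> assumption)
  · have l5 : g (D 5) + z 5 < 0 := by linarith
    refine ⟨g, hgh, 0, 5, by norm_num, by norm_num, fun k hk hk' => ?_, fun k hk hk' => ?_⟩ <;>
      simp only [Nat.reduceAdd] at hk hk' <;>
        (interval_cases k <;> assumption)

theorem isTiltable_of_isSpoked {D : ℕ → Fin 6} {z : ℕ → ℝ} (hD : ∀ k, D (k + 6) = D k)
    (hz : ∀ k, z (k + 6) = z k) (hinj : ∀ i < 6, ∀ j < 6, D i = D j → i = j)
    (h : IsSpoked (fun j => D j)) (hsum : z 0 + z 1 + z 2 + z 3 + z 4 + z 5 = 0)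
    (h0 : z 0 + z 1 ≠ 0) (h2 : z 2 + z 3 ≠ 0) (h4 : z 4 + z 5 ≠ 0) : IsTiltable D z := by
  obtain ⟨h1, h3, h5⟩ := h
  change D 1 = D 0 + 3 at h1
  change D 3 = D 2 + 3 at h3
  change D 5 = D 4 + 3 at h5
  have hne : ∀ {i j}, i < 6 → j < 6 → i ≠ j → D i ≠ D j := fun hi hj hij h =>
    hij (hinj _ hi _ hj h)
  have key : ∀ y : ℕ → ℝ, (∀ k, y (k + 6) = y k) → y 0 + y 1 + y 2 + y 3 + y 4 + y 5 = 0 →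
      (0 < y 0 + y 1 ∧ 0 < y 2 + y 3 ∨ 0 < y 2 + y 3 ∧ 0 < y 4 + y 5 ∨
        0 < y 4 + y 5 ∧ 0 < y 0 + y 1) → IsTiltable D y := by
    rintro y hy hsum (⟨p, q⟩ | ⟨p, q⟩ | ⟨p, q⟩)
    · exact isTiltable_of_isSpoked_of_pos hD hy (hne (by norm_num) (by norm_num) (by norm_num))
        (hne (by norm_num) (by norm_num) (by norm_num))
        (hne (by norm_num) (by norm_num) (by norm_num))
        (hne (by norm_num) (by norm_num) (by norm_num)) h1 h3 h5 p q (by linarith)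
    · refine IsTiltable.of_shift 2 (isTiltable_of_isSpoked_of_pos (fun k => hD (2 + k))
        (fun k => hy (2 + k)) (hne (by norm_num) (by norm_num) (by norm_num))
        (hne (by norm_num) (by norm_num) (by norm_num)) ?_ ?_ h3 h5 ?_ p q ?_)
      · exact (hD 0).symm ▸ hne (by norm_num) (by norm_num) (by norm_num)
      · exact (hD 1).symm ▸ hne (by norm_num) (by norm_num) (by norm_num)
      · exact (hD 1).trans (h1.trans (congrArg (· + 3) (hD 0).symm))
      · linarith [hy 0, hy 1]
    · refine IsTiltable.of_shift 4 (isTiltable_of_isSpoked_of_pos (fun k => hD (4 + k))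
        (fun k => hy (4 + k)) ?_ ?_ ?_ ?_ h5 ?_ ?_ p ?_ ?_)
      · exact (hD 0).symm ▸ hne (by norm_num) (by norm_num) (by norm_num)
      · exact (hD 0).symm ▸ hne (by norm_num) (by norm_num) (by norm_num)
      · exact (hD 0).symm ▸ (hD 2).symm ▸ hne (by norm_num) (by norm_num) (by norm_num)
      · exact (hD 0).symm ▸ (hD 3).symm ▸ hne (by norm_num) (by norm_num) (by norm_num)
      · exact (hD 1).trans (h1.trans (congrArg (· + 3) (hD 0).symm))
      · exact (hD 3).trans (h3.trans (congrArg (· + 3) (hD 2).symm))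
      · linarith [hy 0, hy 1]
      · linarith [hy 2, hy 3]
  -- Two of three nonzero pair sums share a sign; if it is negative, all heights are negated.
  by_cases hp : 0 < z 0 + z 1 ∧ 0 < z 2 + z 3 ∨ 0 < z 2 + z 3 ∧ 0 < z 4 + z 5 ∨
        0 < z 4 + z 5 ∧ 0 < z 0 + z 1
  · exact key z hz hsum hp
  · refine IsTiltable.of_neg hD hz (key _ (fun k => by rw [hz]) (by linarith) ?_)
    by_contra hq
    rcases h0.lt_or_gt with a | a <;> rcases h2.lt_or_gt with b | b <;>
      rcases h4.lt_or_gt with c | c <;> grind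

/-- The tilt has two free parameters and preserves the slope sums of the triangle and of each
opposite pair. Five signs are prescribed; the remaining edge lies between the two blocks, so it only
has to be non-horizontal. -/
theorem isTiltable_of_isDoubledTriangle {D : ℕ → Fin 6} {z : ℕ → ℝ} (hD : ∀ k, D (k + 6) = D k)
    (hz : ∀ k, z (k + 6) = z k)
    (h : IsDoubledTriangle (fun j => D j)) (hsum : z 0 + z 1 + z 2 + z 3 + z 4 + z 5 = 0)
    (hA : z 0 + z 1 + z 2 ≠ 0) (hBC : (z 5 + z 0) * (z 2 + z 3) < 0) : IsTiltable D z := by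
  wlog hC : 0 < z 2 + z 3 generalizing z
  · refine IsTiltable.of_neg hD hz (this (fun k => by rw [hz]) (by linarith) ?_ (by linarith) ?_)
    · intro h; apply hA; linarith
    · have : z 2 + z 3 ≠ 0 := by rintro h; rw [h] at hBC; linarith
      have := lt_of_le_of_ne (not_lt.1 hC) this
      linarith
  have hB : z 5 + z 0 < 0 := by nlinarith
  obtain ⟨⟨h3, h4, h5⟩, h12⟩ := h
  change D 3 = D 2 + 3 at h3
  change D 4 = D 1 + 3 at h4
  change D 5 = D 0 + 3 at h5
  have hform : ∀ x y, ∃ g, IsHexForm g ∧ g (D 0) = x ∧ g (D 1) = y ∧ g (D 2) = -(x + y) ∧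
      g (D 3) = x + y ∧ g (D 4) = -y ∧ g (D 5) = -x := by
    intro x y
    obtain ⟨g, hg, e0, e1, e2⟩ : ∃ g, IsHexForm g ∧ g (D 0) = x ∧ g (D 1) = y ∧
        g (D 2) = -(x + y) := by
      rcases h12 with ⟨h1, h2⟩ | ⟨h1, h2⟩
      · change D 1 = D 0 + 2 at h1
        change D 2 = D 0 + 4 at h2
        refine ⟨_, isHexForm_hexForm (D 0) x (x + y), ?_, ?_, ?_⟩
        · simp [hexForm, hexX, hexY]
        · simp [h1, hexForm, hexX, hexY]
        · simp [h2, hexForm, hexX, hexY]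
      · change D 1 = D 0 + 4 at h1
        change D 2 = D 0 + 2 at h2
        refine ⟨_, isHexForm_hexForm (D 0) x (-y), ?_, ?_, ?_⟩
        · simp [hexForm, hexX, hexY]
        · simp [h1, hexForm, hexX, hexY]
        · simp [h2, hexForm, hexX, hexY]; ring
    refine ⟨g, hg, e0, e1, e2, ?_, ?_, ?_⟩
    · rw [h3, hg.add_three, e2, neg_neg]
    · rw [h4, hg.add_three, e1]
    · rw [h5, hg.add_three, e0]
  rcases hA.lt_or_gt with hA | hA
  · obtain ⟨δ, hδ, hδA, hδC⟩ : ∃ δ > 0, δ < -(z 0 + z 1 + z 2) ∧ δ < z 2 + z 3 := by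
      obtain ⟨δ, h1, h2⟩ := exists_between
        (show 0 < min (-(z 0 + z 1 + z 2)) (z 2 + z 3) from lt_min (by linarith) hC)
      exact ⟨δ, h1, h2.trans_le (min_le_left _ _), h2.trans_le (min_le_right _ _)⟩
    -- The tilted slopes of edges 0, 2 and 3 will be `b`, `z 2 + z 3 - δ` and `δ`. The interval for
    -- `b` makes edges 4 and 5 positive; the excluded value makes edge 1 horizontal.
    obtain ⟨b, ⟨hb0, hb1⟩, hb, -⟩ := exists_mem_Ioo_ne_ne
      (show z 0 + z 1 + z 2 + δ + (z 5 + z 0) < z 5 + z 0 by linarith)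
      (z 0 + z 1 + z 2 - (z 2 + z 3) + δ) 0
    obtain ⟨g, hg, e0, e1, e2, e3, e4, e5⟩ := hform (b - z 0)
      (z 0 + z 1 + z 2 - (z 2 + z 3) + δ - b - z 1)
    have p0 : g (D 0) + z 0 < 0 := by linarith
    have p2 : 0 < g (D 2) + z 2 := by linarith
    have p3 : 0 < g (D 3) + z 3 := by linarith
    have p4 : 0 < g (D 4) + z 4 := by linarith
    have p5 : 0 < g (D 5) + z 5 := by linarith
    have n1 : g (D 1) + z 1 ≠ 0 := by
      intro h
      apply hb
      linarith
    rcases n1.lt_or_gt with p1 | p1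
    · rw [← hD 0, ← hz 0] at p0
      rw [← hD 1, ← hz 1] at p1
      refine ⟨g, hg, 2, 4, by norm_num, by norm_num, fun k hk hk' => ?_, fun k hk hk' => ?_⟩ <;>
        simp only [Nat.reduceAdd] at hk hk' <;>
        (interval_cases k <;> assumption)
    · rw [← hD 0, ← hz 0] at p0
      refine ⟨g, hg, 1, 5, by norm_num, by norm_num, fun k hk hk' => ?_, fun k hk hk' => ?_⟩ <;>
        simp only [Nat.reduceAdd] at hk hk' <;>
        (interval_cases k <;> assumption)
  · obtain ⟨δ, hδ, hδA, hδC⟩ : ∃ δ > 0, δ < z 0 + z 1 + z 2 ∧ δ < z 2 + z 3 := by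
      obtain ⟨δ, h1, h2⟩ := exists_between
        (show 0 < min (z 0 + z 1 + z 2) (z 2 + z 3) from lt_min hA hC)
      exact ⟨δ, h1, h2.trans_le (min_le_left _ _), h2.trans_le (min_le_right _ _)⟩
    -- Now edges 0, 2 and 3 get slopes `b`, `δ` and `z 2 + z 3 - δ`. The interval makes edges 0 and
    -- 1 positive; the excluded value makes edge 4 horizontal.
    obtain ⟨b, ⟨hb0, hb1⟩, hb, -⟩ := exists_mem_Ioo_ne_ne
      (show 0 < z 0 + z 1 + z 2 - δ by linarith)
      (z 0 + z 1 + z 2 - δ + (z 2 + z 3) + (z 5 + z 0)) 0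
    obtain ⟨g, hg, e0, e1, e2, e3, e4, e5⟩ := hform (b - z 0)
      (z 0 + z 1 + z 2 - δ - b - z 1)
    have p0 : 0 < g (D 0) + z 0 := by linarith
    have p1 : 0 < g (D 1) + z 1 := by linarith
    have p2 : 0 < g (D 2) + z 2 := by linarith
    have p3 : 0 < g (D 3) + z 3 := by linarith
    have p5 : g (D 5) + z 5 < 0 := by linarith
    have n4 : g (D 4) + z 4 ≠ 0 := by
      intro h
      apply hb
      linarith
    rcases n4.lt_or_gt with p4 | p4
    · refine ⟨g, hg, 0, 4, by norm_num, by norm_num, fun k hk hk' => ?_, fun k hk hk' => ?_⟩ <;>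
        simp only [Nat.reduceAdd] at hk hk' <;>
        (interval_cases k <;> assumption)
    · refine ⟨g, hg, 0, 5, by norm_num, by norm_num, fun k hk hk' => ?_, fun k hk hk' => ?_⟩ <;>
        simp only [Nat.reduceAdd] at hk hk' <;>
        (interval_cases k <;> assumption)

/-! ### The regular hexagon and the conclusion -/

open Real in
/-- The edges of a regular hexagon in the basis formed by its first two edges. -/
theorem exists_regularHexagon_basis (c : Plane) {r : ℝ} (hr : 0 < r) (θ : ℝ) :
    ∃ e f : Fin 2 → ℝ, e 0 * f 1 - e 1 * f 0 ≠ 0 ∧ ∀ (k : Fin 6) (i : Fin 2),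
      (regularVertex c r θ (k + 1) - regularVertex c r θ k) i = hexX k * e i + hexY k * f i := by
  set x := cos θ with hx
  set y := sin θ with hy
  have hxy : y ^ 2 + x ^ 2 = 1 := sin_sq_add_cos_sq θ
  set q := √3 with hq
  have hqq : q * q = 3 := mul_self_sqrt (by norm_num)
  have hq0 : 0 < q := by positivity
  have c1 : cos (θ + 2 * π * (1 : ℕ) / (6 : ℕ)) = x / 2 - y * q / 2 := by
    rw [show θ + 2 * π * (1 : ℕ) / (6 : ℕ) = θ + π / 3 by push_cast; ring, cos_add,
      cos_pi_div_three, sin_pi_div_three]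
    ring
  have s1 : sin (θ + 2 * π * (1 : ℕ) / (6 : ℕ)) = y / 2 + x * q / 2 := by
    rw [show θ + 2 * π * (1 : ℕ) / (6 : ℕ) = θ + π / 3 by push_cast; ring, sin_add,
      cos_pi_div_three, sin_pi_div_three]
    ring
  have c2' : cos (2 * (π / 3)) = -1 / 2 := by rw [cos_two_mul, cos_pi_div_three]; norm_num
  have s2' : sin (2 * (π / 3)) = q / 2 := by
    rw [sin_two_mul, cos_pi_div_three, sin_pi_div_three]; ring
  have c2 : cos (θ + 2 * π * (2 : ℕ) / (6 : ℕ)) = -x / 2 - y * q / 2 := by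
    rw [show θ + 2 * π * (2 : ℕ) / (6 : ℕ) = θ + 2 * (π / 3) by push_cast; ring, cos_add,
      c2', s2']
    ring
  have s2 : sin (θ + 2 * π * (2 : ℕ) / (6 : ℕ)) = -y / 2 + x * q / 2 := by
    rw [show θ + 2 * π * (2 : ℕ) / (6 : ℕ) = θ + 2 * (π / 3) by push_cast; ring, sin_add,
      c2', s2']
    ring
  have c3 : cos (θ + 2 * π * (3 : ℕ) / (6 : ℕ)) = -x := by
    rw [show θ + 2 * π * (3 : ℕ) / (6 : ℕ) = θ + π by push_cast; ring, cos_add_pi]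
  have s3 : sin (θ + 2 * π * (3 : ℕ) / (6 : ℕ)) = -y := by
    rw [show θ + 2 * π * (3 : ℕ) / (6 : ℕ) = θ + π by push_cast; ring, sin_add_pi]
  have c4 : cos (θ + 2 * π * (4 : ℕ) / (6 : ℕ)) = -(x / 2 - y * q / 2) := by
    rw [← c1, ← cos_add_pi]
    congr 1
    push_cast; ring
  have s4 : sin (θ + 2 * π * (4 : ℕ) / (6 : ℕ)) = -(y / 2 + x * q / 2) := by
    rw [← s1, ← sin_add_pi]
    congr 1
    push_cast; ring
  have c5 : cos (θ + 2 * π * (5 : ℕ) / (6 : ℕ)) = -(-x / 2 - y * q / 2) := by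
    rw [← c2, ← cos_add_pi]
    congr 1
    push_cast; ring
  have s5 : sin (θ + 2 * π * (5 : ℕ) / (6 : ℕ)) = -(-y / 2 + x * q / 2) := by
    rw [← s2, ← sin_add_pi]
    congr 1
    push_cast; ring
  have c0 : cos (θ + 2 * π * (0 : ℕ) / (6 : ℕ)) = x := by simp [hx]
  have s0 : sin (θ + 2 * π * (0 : ℕ) / (6 : ℕ)) = y := by simp [hy]
  refine ⟨![r * (-x / 2 - y * q / 2), r * (-y / 2 + x * q / 2)], ![r * (-x), r * (-y)], ?_, ?_⟩
  · have : r * (-x / 2 - y * q / 2) * (r * -y) - r * (-y / 2 + x * q / 2) * (r * -x) =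
        r ^ 2 * q / 2 * (y ^ 2 + x ^ 2) := by ring
    simp only [Matrix.cons_val_zero, Matrix.cons_val_one]
    rw [this, hxy]
    positivity
  · intro k i
    have hv : ∀ (j : Fin 6) (i : Fin 2), regularVertex c r θ j i = c i + r *
        ![cos (θ + 2 * π * (j : ℕ) / (6 : ℕ)), sin (θ + 2 * π * (j : ℕ) / (6 : ℕ))] i := by
      intro j i
      fin_cases i <;> rfl
    rw [PiLp.sub_apply, hv, hv]
    have v0 : ((0 : Fin 6) : ℕ) = 0 := rfl
    have v1 : ((1 : Fin 6) : ℕ) = 1 := rfl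
    have v2 : ((2 : Fin 6) : ℕ) = 2 := rfl
    have v3 : ((3 : Fin 6) : ℕ) = 3 := rfl
    have v4 : ((4 : Fin 6) : ℕ) = 4 := rfl
    have v5 : ((5 : Fin 6) : ℕ) = 5 := rfl
    have a1 : (0 : Fin 6) + 1 = 1 := rfl
    have a2 : (1 : Fin 6) + 1 = 2 := rfl
    have a3 : (2 : Fin 6) + 1 = 3 := rfl
    have a4 : (3 : Fin 6) + 1 = 4 := rfl
    have a5 : (4 : Fin 6) + 1 = 5 := rfl
    have a6 : (5 : Fin 6) + 1 = 0 := rfl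
    obtain rfl | rfl | rfl | rfl | rfl | rfl : k = 0 ∨ k = 1 ∨ k = 2 ∨ k = 3 ∨ k = 4 ∨ k = 5 := by
      revert k; decide
    all_goals
      simp only [a1, a2, a3, a4, a5, a6, v0, v1, v2, v3, v4, v5, c0, s0, c1, s1, c2, s2, c3, s3,
        c4, s4, c5, s5]
      fin_cases i <;> simp [hexX, hexY] <;> ring

theorem vertex_ne {w : Fin 6 → Space} (h : IsSimpleClosed w) {i j : ℕ} (hij : i % 6 ≠ j % 6) :
    vertex w i ≠ vertex w j := by
  intro heq
  apply hij
  apply h.mod_eq_of_add_smul_eq (t := 0) (u := 0) (by simp) (by simp)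
  simpa using heq

/-- A simple closed hexagon whose edges project to the six edges of a regular hexagon can be
tilted so that it has a single local maximum. -/
theorem IsSimpleClosed.isTiltable {w : Fin 6 → Space} (h : IsSimpleClosed w) (d : Fin 6 → Fin 6)
    (hd : Function.Injective d) (e f : Fin 2 → ℝ)
    (h0 : ∀ k, w k 0 = hexX (d k) * e 0 + hexY (d k) * f 0)
    (h1 : ∀ k, w k 1 = hexX (d k) * e 1 + hexY (d k) * f 1) :
    IsTiltable (fun k => d (Fin.ofNat 6 k)) (fun k => w (Fin.ofNat 6 k) 2) := by
  obtain ⟨s, hs⟩ := hasForm_of_injective d hd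
  set W : ℕ → Space := fun k => w (Fin.ofNat 6 (s + k)) with hW
  set D : ℕ → Fin 6 := fun k => d (Fin.ofNat 6 (s + k)) with hDdef
  have hper : ∀ k, Fin.ofNat 6 (s + (k + 6)) = Fin.ofNat 6 (s + k) := by
    intro k
    simp [Fin.ext_iff, ← add_assoc]
  have hD : ∀ k, D (k + 6) = D k := fun k => congrArg d (hper k)
  have hz : ∀ k, W (k + 6) 2 = W k 2 := fun k => congrArg (fun i => w i 2) (hper k)
  have hinj : ∀ i < 6, ∀ j < 6, D i = D j → i = j := by
    intro i hi j hj hij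
    have := congrArg Fin.val (hd hij)
    simp only [Fin.val_ofNat] at this
    omega
  have hofs : ∀ j : Fin 6, s + j = Fin.ofNat 6 (s + (j : ℕ)) := fun j => by
    simp [Fin.ext_iff, Fin.val_add]
  simp only [hofs] at hs
  refine IsTiltable.of_shift s ?_
  change IsTiltable D (fun k => W k 2)
  have hvs : ∀ k, vertex w (s + (k + 1)) = vertex w (s + k) + W k := fun k => vertex_succ w _
  have hsum : W 0 + W 1 + W 2 + W 3 + W 4 + W 5 = 0 := by
    have := vertex_add_period h.1 s
    rw [hvs 5, hvs 4, hvs 3, hvs 2, hvs 1, hvs 0] at this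
    simpa [add_assoc] using this
  have hsum2 : W 0 2 + W 1 2 + W 2 2 + W 3 2 + W 4 2 + W 5 2 = 0 := by
    simpa using congrArg (fun x : Space => x 2) hsum
  have hX : ∀ k : Fin 6, hexX (k + 3) = -hexX k :=
    IsHexForm.add_three ⟨1, 0, fun k => by ring⟩
  have hY : ∀ k : Fin 6, hexY (k + 3) = -hexY k :=
    IsHexForm.add_three ⟨0, 1, fun k => by ring⟩
  have hopp : ∀ i j, D j = D i + 3 → W i 0 + W j 0 = 0 ∧ W i 1 + W j 1 = 0 := by
    intro i j hij
    change d _ = d _ + 3 at hij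
    simp only [hW, h0, h1, hij, hX, hY]
    constructor <;> ring
  have hvert : ∀ x : Space, x ≠ 0 → x 0 = 0 → x 1 = 0 → x 2 ≠ 0 := by
    intro x hx h0 h1 h2
    apply hx
    ext i
    fin_cases i <;> assumption
  have hne : ∀ i j, i < j → j < i + 6 → vertex w (s + j) - vertex w (s + i) ≠ 0 := by
    intro i j hi hj
    exact sub_ne_zero.2 (vertex_ne h (by omega))
  -- The vertices before and after an opposite pair lie over the same point of the plane, so their
  -- heights differ.
  have hpair : ∀ i, D (i + 1) = D i + 3 → W i 2 + W (i + 1) 2 ≠ 0 := by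
    intro i hi
    have h2 := hne i (i + 2) (by omega) (by omega)
    rw [hvs (i + 1), hvs i, show ∀ x y z : Space, x + y + z - x = y + z by intros; abel] at h2
    obtain ⟨a, b⟩ := hopp _ _ hi
    simpa using hvert _ h2 (by simpa using a) (by simpa using b)
  rcases hs with hs | hs | hs | hs
  · exact isTiltable_of_isHalfSplit hs
  · exact isTiltable_of_isSpoked hD hz hinj hs hsum2 (hpair 0 hs.1) (hpair 2 hs.2.1)
      (hpair 4 hs.2.2)
  · exact isTiltable_of_isOneSpike hD hz hs (hpair 0 hs.1)
  · obtain ⟨e23, e14, e05⟩ : D 3 = D 2 + 3 ∧ D 4 = D 1 + 3 ∧ D 5 = D 0 + 3 := hs.1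
    have htri : W 0 0 + W 1 0 + W 2 0 = 0 ∧ W 0 1 + W 1 1 + W 2 1 = 0 := by
      have hXY : ∀ k : Fin 6, hexX k + hexX (k + 2) + hexX (k + 4) = 0 ∧
          hexY k + hexY (k + 2) + hexY (k + 4) = 0 := by
        intro k
        fin_cases k <;> simp [hexX, hexY]
      obtain ⟨x0, y0⟩ := hXY (D 0)
      have h12 : D 1 = D 0 + 2 ∧ D 2 = D 0 + 4 ∨ D 1 = D 0 + 4 ∧ D 2 = D 0 + 2 := hs.2
      have hW0 : ∀ k, W k 0 = hexX (D k) * e 0 + hexY (D k) * f 0 := fun k => h0 _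
      have hW1 : ∀ k, W k 1 = hexX (D k) * e 1 + hexY (D k) * f 1 := fun k => h1 _
      rcases h12 with ⟨e1, e2⟩ | ⟨e1, e2⟩ <;> simp only [hW0, hW1, e1, e2] <;> constructor
      all_goals first
        | linear_combination e 0 * x0 + f 0 * y0
        | linear_combination e 1 * x0 + f 1 * y0
    obtain ⟨a23, b23⟩ := hopp _ _ e23
    obtain ⟨a14, b14⟩ := hopp _ _ e14
    have hA : W 0 2 + W 1 2 + W 2 2 ≠ 0 := by
      have h2 := hne 0 3 (by omega) (by omega)
      rw [hvs 2, hvs 1, hvs 0,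
        show ∀ x y z u : Space, x + y + z + u - x = y + z + u by intros; abel] at h2
      simpa using hvert _ h2 (by simpa using htri.1) (by simpa using htri.2)
    have hB : W 5 2 + W 0 2 ≠ 0 := by
      have h2 := hne 1 5 (by omega) (by omega)
      rw [hvs 4, hvs 3, hvs 2, hvs 1,
        show ∀ x y z u v : Space, x + y + z + u + v - x = y + z + u + v by intros; abel] at h2
      have := hvert _ h2 (by simp; linarith) (by simp; linarith)
      simp at this
      intro h
      apply this
      linarith
    have hC : W 2 2 + W 3 2 ≠ 0 := hpair 2 e23
    refine isTiltable_of_isDoubledTriangle hD hz hs hsum2 hA ?_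
    by_contra hcon
    set B := W 5 2 + W 0 2 with hBdef
    set C := W 2 2 + W 3 2 with hCdef
    have hBC : 0 < B * C := lt_of_le_of_ne (not_lt.1 hcon) (mul_ne_zero hB hC).symm
    -- Edges 1 and 4 lie over the same segment, traversed in opposite directions. At parameter `t`
    -- of edge 1 and `1 - t` of edge 4 their height difference is `-B + t * (B + C)`, running from
    -- `-B` to `C`. If `B` and `C` had the same sign, the edges would cross at its zero.
    obtain ⟨t, ht0, ht1, ht⟩ : ∃ t : ℝ, 0 < t ∧ t < 1 ∧ t * (B + C) = B := by
      rcases pos_and_pos_or_neg_and_neg_of_mul_pos hBC with ⟨b, c⟩ | ⟨b, c⟩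
      · exact ⟨B / (B + C), by positivity, (div_lt_one (by positivity)).2 (by linarith),
          div_mul_cancel₀ _ (by positivity)⟩
      · have : B + C < 0 := by linarith
        exact ⟨B / (B + C), div_pos_of_neg_of_neg b this, (div_lt_one_of_neg this).2 (by linarith),
          div_mul_cancel₀ _ this.ne⟩
    have hmod := h.mod_eq_of_add_smul_eq (i := s + 1) (j := s + 4) (t := t) (u := 1 - t)
      ⟨ht0.le, ht1⟩ ⟨by linarith, by linarith⟩ (by
        change vertex w (s + 1) + t • W 1 = vertex w (s + 4) + (1 - t) • W 4
        rw [hvs 3, hvs 2, hvs 1]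
        ext i
        fin_cases i
        · simp; linear_combination -a23 - (1 - t) * a14
        · simp; linear_combination -b23 - (1 - t) * b14
        · simp
          have e4 : W 4 2 = -(W 1 2) - B - C := by simp only [hBdef, hCdef]; linarith
          rw [e4]
          linear_combination hCdef - ht)
    omega

theorem mainTheorem2 (v : Fin 6 → Space) (hv : ProjectsToRegularPolygon v)
    (σ : Equiv.Perm (Fin 6)) (hσ : IsSimpleClosed (v ∘ σ)) :
    IsUnknot (polygonalCurve (v ∘ σ)) := by
  obtain ⟨c, r, θ, τ, hr, hτ⟩ := hv
  obtain ⟨e, f, hef, hE⟩ := exists_regularHexagon_basis c hr θ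
  have hw : ∀ (k : Fin 6) (i : Fin 2), planeProj ((v ∘ σ) k) i =
      hexX ((σ.trans τ.symm) k) * e i + hexY ((σ.trans τ.symm) k) * f i := by
    intro k i
    rw [← hE, ← hτ]
    simp
  obtain ⟨g, ⟨x, y, hg⟩, s, m, hm, hm', hpos, hneg⟩ :=
    hσ.isTiltable (σ.trans τ.symm) (σ.trans τ.symm).injective e f (fun k => hw k 0) (fun k => hw k 1)
  set δ := e 0 * f 1 - e 1 * f 0 with hδ
  -- By Cramer's rule, these coefficients define the functional with values `x` on `e` and `y` on
  -- `f`.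
  have hform : ∀ k, (x * f 1 - y * e 1) / δ * (v ∘ σ) k 0 + (y * e 0 - x * f 0) / δ * (v ∘ σ) k 1 =
      g ((σ.trans τ.symm) k) := by
    intro k
    have a : (v ∘ σ) k 0 = _ := hw k 0
    have b : (v ∘ σ) k 1 = _ := hw k 1
    rw [hg, a, b, div_mul_eq_mul_div, div_mul_eq_mul_div, ← add_div, div_eq_iff hef]
    ring
  refine hσ.isUnknot_of_unimodal ((x * f 1 - y * e 1) / δ) ((y * e 0 - x * f 0) / δ) s m hm hm'
    (fun k hk hk' => ?_) (fun k hk hk' => ?_)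
  · rw [hform, add_comm]
    exact hpos k hk hk'
  · rw [hform, add_comm]
    exact hneg k hk hk'
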